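/- \textbf{Proposition 8 (strong uncertainty principle).} \emph{Setting.} All manifolds are real $C^\infty$ Banach manifolds without boundary. Let $M$ be a connected, Hausdorff, second countable Banach manifold and $G$ a Hausdorff, second countable Banach Lie group acting smoothly and transitively on $M$, such that every isotropy group $G_x$ is a Lie subgroup (a split submanifold) of $G$. Let $s$ be an involutive diffeomorphism of $M$ with an isolated fixed point $o$; for $a\in G$ the map $a\circ s\circ a^{-1}$ is called the symmetry at $a\cdot o$. Let $\mathsf g$ be a smooth Riemannian metric on $M$ (inducing on each tangent space its given topology) which is invariant under $G$ and under all symmetries, and let $J$ be a smooth almost complex structure on $M$ ($J_x^2=-1$) which is invariant under all symmetries and satisfies $\mathsf g_x(J_xv,J_xw)=\mathsf g_x(v,w)$. Such data $(M,G,s,\mathsf g,J)$ form a \emph{Hermitian symmetric space}. Put $\omega_x(v,w)=\mathsf g_x(J_xv,w)$ and $\|v\|_{\mathsf g}=\mathsf g_x(v,v)^{1/2}$. Let $r$ be the infimum of all $a\ge 0$ such that $|\omega_x(v,w)|\le a\,\|v\|_{\mathsf g}\|w\|_{\mathsf g}$ for all $x\in M$ and $v,w\in T_xM$, and define the dispersion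 of a smooth vector field $X$ at $x$ by $$\Delta_xX=\sqrt{r/2}\;\mathsf g_x(X_x,X_x)^{1/2}.$$ A \emph{Killing vector field} is a complete smooth vector field whose flow preserves $\mathsf g$. \emph{Statement.} Let $M$ be a Hermitian symmetric space, $X$ a smooth vector field on $M$ and $x\in M$. Then for every smooth vector field $Y$ on $M$ $$\Delta_xX\;\Delta_xY\;\ge\;\tfrac12\,|\omega_x(X_x,Y_x)|,$$ and there is a Killing vector field $K$ on $M$ with $K_x=J_xX_x$ for which equality holds: $$\Delta_xX\;\Delta_xK\;=\;\tfrac12\,|\omega_x(X_x,K_x)|.$$ -/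

import Mathlib

open Set Filter Topology Bundle
open scoped Manifold ContDiff

noncomputable section

/-! ### Smooth tensors on a (real, possibly infinite dimensional) Banach manifold

All manifolds are modelled on a real Banach space `E` (no boundary), and smooth means `C^∞`. -/

/-- Smooth vector fields on `M`. -/
abbrev SmoothVectorField (E M : Type*) [NormedAddCommGroup E] [NormedSpace ℝ E]
    [TopologicalSpace M] [ChartedSpace E M] [IsManifold 𝓘(ℝ, E) ∞ M] :=
  ContMDiffSection 𝓘(ℝ, E) E ∞ (fun x : M => TangentSpace 𝓘(ℝ, E) x)

/-- Smooth Riemannian metrics on `M` (inducing on each tangent space its given topology). -/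
abbrev SmoothMetric (E M : Type*) [NormedAddCommGroup E] [NormedSpace ℝ E]
    [TopologicalSpace M] [ChartedSpace E M] [IsManifold 𝓘(ℝ, E) ∞ M] :=
  ContMDiffRiemannianMetric 𝓘(ℝ, E) ∞ E (fun x : M => TangentSpace 𝓘(ℝ, E) x)

/-- An almost complex structure: a smooth tensor field whose value at `x` is a complex structure
on the tangent space at `x`. -/
structure AlmostComplexStructure (E M : Type*) [NormedAddCommGroup E] [NormedSpace ℝ E]
    [TopologicalSpace M] [ChartedSpace E M] [IsManifold 𝓘(ℝ, E) ∞ M] where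
  /-- The endomorphism `J_x` of the tangent space at `x`. -/
  toFun (x : M) : TangentSpace 𝓘(ℝ, E) x →L[ℝ] TangentSpace 𝓘(ℝ, E) x
  sq_eq_neg (x : M) (v : TangentSpace 𝓘(ℝ, E) x) : toFun x (toFun x v) = -v
  contMDiff : ContMDiff 𝓘(ℝ, E) (𝓘(ℝ, E).prod 𝓘(ℝ, E →L[ℝ] E)) ∞
    (fun x : M => TotalSpace.mk' (E →L[ℝ] E)
      (E := fun x : M => TangentSpace 𝓘(ℝ, E) x →L[ℝ] TangentSpace 𝓘(ℝ, E) x) x (toFun x))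

section Tensors

variable {E M : Type*} [NormedAddCommGroup E] [NormedSpace ℝ E]
  [TopologicalSpace M] [ChartedSpace E M] [IsManifold 𝓘(ℝ, E) ∞ M]

/-- The map `f` preserves the metric `g`, i.e. `f^* g = g`. -/
def PreservesMetric (g : SmoothMetric E M) (f : M → M) : Prop :=
  ∀ (x : M) (v w : TangentSpace 𝓘(ℝ, E) x),
    g.inner (f x) (mfderiv 𝓘(ℝ, E) 𝓘(ℝ, E) f x v) (mfderiv 𝓘(ℝ, E) 𝓘(ℝ, E) f x w) =
      g.inner x v w

/-- The map `f` is almost complex: its derivative at each point is complex linear. -/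
def IsAlmostComplexMap (J : AlmostComplexStructure E M) (f : M → M) : Prop :=
  ∀ (x : M) (v : TangentSpace 𝓘(ℝ, E) x),
    mfderiv 𝓘(ℝ, E) 𝓘(ℝ, E) f x (J.toFun x v) =
      J.toFun (f x) (mfderiv 𝓘(ℝ, E) 𝓘(ℝ, E) f x v)

/-- The metric `g` is Hermitian with respect to `J`. -/
def IsHermitianMetric (g : SmoothMetric E M) (J : AlmostComplexStructure E M) : Prop :=
  ∀ (x : M) (v w : TangentSpace 𝓘(ℝ, E) x), g.inner x (J.toFun x v) (J.toFun x w) = g.inner x v w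

/-- A Killing vector field: a complete smooth vector field whose (global, smooth) flow `Φ`
preserves the metric. -/
def IsKillingField (g : SmoothMetric E M) (K : SmoothVectorField E M) : Prop :=
  ∃ Φ : ℝ → M → M,
    ContMDiff (𝓘(ℝ, ℝ).prod 𝓘(ℝ, E)) 𝓘(ℝ, E) ∞ (fun p : ℝ × M => Φ p.1 p.2) ∧
    (∀ x, Φ 0 x = x) ∧
    (∀ x, IsMIntegralCurve (I := 𝓘(ℝ, E)) (fun t => Φ t x) (fun y => K y)) ∧
    ∀ t, PreservesMetric g (Φ t)

/-- The fundamental `2`-form `ω_x(v, w) = g_x(J_x v, w)`. -/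
def fundamentalForm (g : SmoothMetric E M) (J : AlmostComplexStructure E M) (x : M)
    (v w : TangentSpace 𝓘(ℝ, E) x) : ℝ :=
  g.inner x (J.toFun x v) w

/-- The norm `(g_x(v, v))^{1/2}` of a tangent vector. -/
def metricNorm (g : SmoothMetric E M) (x : M) (v : TangentSpace 𝓘(ℝ, E) x) : ℝ :=
  √(g.inner x v v)

/-- The fundamental form is uniformly continuous, with constant `a`, with respect to the metric. -/
def UncertaintyBound (g : SmoothMetric E M) (J : AlmostComplexStructure E M) (a : ℝ) : Prop :=
  ∀ (x : M) (v w : TangentSpace 𝓘(ℝ, E) x),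
    |fundamentalForm g J x v w| ≤ a * (metricNorm g x v * metricNorm g x w)

/-- The best constant `r ≥ 0` in the uncertainty bound. -/
def uncertaintyConstant (g : SmoothMetric E M) (J : AlmostComplexStructure E M) : ℝ :=
  sInf {a : ℝ | 0 ≤ a ∧ UncertaintyBound g J a}

/-- The dispersion `Δ_x X = (r/2)^{1/2} (g_x(X_x, X_x))^{1/2}` of a vector field at `x`. -/
def dispersion (g : SmoothMetric E M) (J : AlmostComplexStructure E M) (X : SmoothVectorField E M)
    (x : M) : ℝ :=
  √(uncertaintyConstant g J / 2) * metricNorm g x (X x)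

end Tensors

/-! ### Homogeneous and symmetric `G` spaces -/

/-- A Lie subgroup of a Banach Lie group: a subgroup which is a split submanifold. By translation
invariance it is enough to have a submanifold chart at the identity, adapted to a closed
complemented subspace of the model space. -/
def IsBanachLieSubgroup (EG : Type*) {G : Type*} [NormedAddCommGroup EG] [NormedSpace ℝ EG]
    [Group G] [TopologicalSpace G] [ChartedSpace EG G] [LieGroup 𝓘(ℝ, EG) ∞ G]
    (H : Subgroup G) : Prop :=
  ∃ e ∈ IsManifold.maximalAtlas 𝓘(ℝ, EG) ∞ G, (1 : G) ∈ e.source ∧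
    ∃ 𝔥 : Submodule ℝ EG, 𝔥.ClosedComplemented ∧
      ∀ g ∈ e.source, g ∈ H ↔ e g - e 1 ∈ 𝔥

/-- A homogeneous `G` space: a smooth transitive action whose isotropy groups are Lie subgroups. -/
structure IsHomogeneousGSpace (EG G E M : Type*)
    [NormedAddCommGroup EG] [NormedSpace ℝ EG]
    [Group G] [TopologicalSpace G] [ChartedSpace EG G] [LieGroup 𝓘(ℝ, EG) ∞ G]
    [NormedAddCommGroup E] [NormedSpace ℝ E]
    [TopologicalSpace M] [ChartedSpace E M] [IsManifold 𝓘(ℝ, E) ∞ M] [MulAction G M] : Prop where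
  smooth : ContMDiffSMul 𝓘(ℝ, EG) 𝓘(ℝ, E) ∞ G M
  transitive : MulAction.IsPretransitive G M
  isotropy (x : M) : IsBanachLieSubgroup EG (MulAction.stabilizer G x)

/-- A symmetric `G` space: a homogeneous `G` space with an involutive diffeomorphism `s` having an
isolated fixed point `o`. -/
structure SymmetricGSpace (EG G E M : Type*)
    [NormedAddCommGroup EG] [NormedSpace ℝ EG]
    [Group G] [TopologicalSpace G] [ChartedSpace EG G] [LieGroup 𝓘(ℝ, EG) ∞ G]
    [NormedAddCommGroup E] [NormedSpace ℝ E]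
    [TopologicalSpace M] [ChartedSpace E M] [IsManifold 𝓘(ℝ, E) ∞ M] [MulAction G M] where
  homogeneous : IsHomogeneousGSpace EG G E M
  /-- The involution. -/
  s : Diffeomorph 𝓘(ℝ, E) 𝓘(ℝ, E) M M ∞
  /-- The base point. -/
  o : M
  involutive : Function.Involutive s
  fixed : s o = o
  isolated : ∀ᶠ y in 𝓝 o, s y = y → y = o

/-- The symmetry `a ∘ s ∘ a⁻¹` at the point `a • o`. -/
def SymmetricGSpace.symmetry {EG G E M : Type*}
    [NormedAddCommGroup EG] [NormedSpace ℝ EG]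
    [Group G] [TopologicalSpace G] [ChartedSpace EG G] [LieGroup 𝓘(ℝ, EG) ∞ G]
    [NormedAddCommGroup E] [NormedSpace ℝ E]
    [TopologicalSpace M] [ChartedSpace E M] [IsManifold 𝓘(ℝ, E) ∞ M] [MulAction G M]
    (S : SymmetricGSpace EG G E M) (a : G) (y : M) : M :=
  a • S.s (a⁻¹ • y)

/-- A Riemannian symmetric `G` space: the metric is invariant under `G` and under the
symmetries. -/
structure RiemannianSymmetricGSpace (EG G E M : Type*)
    [NormedAddCommGroup EG] [NormedSpace ℝ EG]
    [Group G] [TopologicalSpace G] [ChartedSpace EG G] [LieGroup 𝓘(ℝ, EG) ∞ G]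
    [NormedAddCommGroup E] [NormedSpace ℝ E]
    [TopologicalSpace M] [ChartedSpace E M] [IsManifold 𝓘(ℝ, E) ∞ M] [MulAction G M]
    extends SymmetricGSpace EG G E M where
  /-- The Riemannian metric. -/
  g : SmoothMetric E M
  metric_invariant (a : G) : PreservesMetric g (fun y : M => a • y)
  metric_symmetry (a : G) : PreservesMetric g (toSymmetricGSpace.symmetry a)

/-- A Hermitian symmetric `G` space: a Riemannian symmetric `G` space with an almost complex
structure `J` which is invariant under the symmetries and for which the metric is Hermitian. -/
structure HermitianSymmetricGSpace (EG G E M : Type*)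
    [NormedAddCommGroup EG] [NormedSpace ℝ EG]
    [Group G] [TopologicalSpace G] [ChartedSpace EG G] [LieGroup 𝓘(ℝ, EG) ∞ G]
    [NormedAddCommGroup E] [NormedSpace ℝ E]
    [TopologicalSpace M] [ChartedSpace E M] [IsManifold 𝓘(ℝ, E) ∞ M] [MulAction G M]
    extends RiemannianSymmetricGSpace EG G E M where
  /-- The almost complex structure. -/
  J : AlmostComplexStructure E M
  hermitian : IsHermitianMetric g J
  J_symmetry (a : G) : IsAlmostComplexMap J (toSymmetricGSpace.symmetry a)

end

/-! The product of two dispersions is (r/2)‖X‖‖Y‖, so the inequality is the bound defining r. The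
infimum satisfies it: Cauchy–Schwarz for a Hermitian metric makes 1 admissible, and the conditions
on the constant are closed. Since ω(v, Jv) = ‖v‖², a nonzero tangent vector forces r = 1, and
equality holds for any field whose value at x is JX. The difficulty is to find a Killing field with
that value.

Lie algebra elements of G generate one-parameter groups of isometries, so fundamental fields are
Killing. It remains to see that the orbit map a ↦ a • x has surjective derivative at 1
(`surjective_of_hasFDerivAt_orbit_chart`), although transitivity only says that it is onto.

Baire category and second countability make the orbit map almost open, and successive approximation
makes it open (`image_smul_mem_nhds`), even on a slice complementary to the isotropy group
(`eventually_exists_slice_smul_eq`). If a slice element moved x too little for its size, its powers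
would travel a fixed distance away from the isotropy group while barely moving x, contradicting
openness. So the orbit map is bounded below along the slice (`exists_norm_le_norm_slice_smul_sub`).
Its derivative there is then bounded below, hence has closed range, and openness makes the range
dense. -/

noncomputable section

/-! ### Baire category: orbit maps are almost open -/

/-- A manifold modelled on a Baire space whose open subsets are Baire is a Baire space. -/
theorem ChartedSpace.baireSpace (H M : Type*) [TopologicalSpace H] [BaireSpace H]
    [TopologicalSpace M] [ChartedSpace H M] : BaireSpace M where
  baire_property f ho hd := by
    rw [dense_iff_inter_open]
    intro U hU ⟨z, hz⟩
    let φ := chartAt H z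
    have hT : BaireSpace φ.target := φ.open_target.baireSpace
    have hS : BaireSpace φ.source := φ.toHomeomorphSourceTarget.symm.baireSpace
    have hdS : Dense (⋂ n, ((↑) ⁻¹' f n : Set φ.source)) := by
      apply dense_iInter_of_isOpen
      · exact fun n => (ho n).preimage continuous_subtype_val
      · exact fun n => (hd n).preimage φ.open_source.isOpenMap_subtype_val
    obtain ⟨w, hwU, hw⟩ := hdS.inter_open_nonempty _ (hU.preimage continuous_subtype_val)
      ⟨⟨z, mem_chart_source H z⟩, hz⟩
    refine ⟨w, hwU, ?_⟩
    simpa using hw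

open scoped Pointwise in
/-- A separable group acting continuously and transitively on a Baire space acts almost openly. -/
theorem closure_image_smul_mem_nhds {G M : Type*} [Group G] [TopologicalSpace G]
    [IsTopologicalGroup G] [SecondCountableTopology G] [TopologicalSpace M] [BaireSpace M]
    [MulAction G M] [ContinuousSMul G M] [MulAction.IsPretransitive G M] {U : Set G}
    (hU : U ∈ 𝓝 (1 : G)) (x : M) : closure ((fun a : G => a • x) '' U) ∈ 𝓝 x := by
  obtain ⟨V, V_mem, -, V_symm, VU⟩ : ∃ V ∈ 𝓝 (1 : G), IsClosed V ∧ V⁻¹ = V ∧ V * V ⊆ U :=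
    exists_closed_nhds_one_inv_eq_mul_subset hU
  have : Nonempty M := ⟨x⟩
  let d := TopologicalSpace.denseSeq G
  -- Countably many translates of `V` cover the group, so Baire gives one orbit piece whose closure
  -- has interior; translating back, `V` itself has this property.
  have hcov : ∀ h : G, ∃ n, h ∈ d n • V := by
    intro h
    have hN : (fun a : G => a⁻¹ * h) ⁻¹' V ∈ 𝓝 h := by
      refine ContinuousAt.preimage_mem_nhds (by fun_prop) ?_
      simpa using V_mem
    obtain ⟨n, hn⟩ := (TopologicalSpace.denseRange_denseSeq G).exists_mem_open isOpen_interior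
      ⟨h, mem_interior_iff_mem_nhds.2 hN⟩
    exact ⟨n, by simpa [mem_smul_set_iff_inv_smul_mem] using interior_subset hn⟩
  let F : ℕ → Set M := fun n => closure ((d n • V) • ({x} : Set M))
  obtain ⟨n, hn⟩ : ∃ n, (interior (F n)).Nonempty := by
    apply nonempty_interior_of_iUnion_of_closed (fun n => isClosed_closure)
    refine eq_univ_iff_forall.2 fun y => ?_
    obtain ⟨h, rfl⟩ := MulAction.exists_smul_eq G x y
    obtain ⟨n, hn⟩ := hcov h
    exact mem_iUnion.2 ⟨n, subset_closure ⟨h, hn, x, rfl, rfl⟩⟩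
  obtain ⟨y, hy⟩ : (interior (closure (V • ({x} : Set M)))).Nonempty := by
    simp only [F] at hn
    rw [smul_assoc, closure_smul, interior_smul] at hn
    exact smul_set_nonempty.1 hn
  -- The interior point may be taken in the orbit piece itself, as `g' • x` with `g' ∈ V`.
  -- Translation by `g'⁻¹` then recentres at `x`, and `V⁻¹ * V ⊆ U`.
  obtain ⟨y', hy', hyV⟩ := mem_closure_iff.1 (interior_subset hy) _ isOpen_interior hy
  obtain ⟨g', hg', rfl⟩ : ∃ g' ∈ V, g' • x = y' := by simpa using hyV
  have J : closure ((g'⁻¹ • V) • {x}) ∈ 𝓝 x := by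
    apply mem_interior_iff_mem_nhds.1
    rwa [smul_assoc, closure_smul, interior_smul, mem_inv_smul_set_iff]
  refine mem_of_superset J (closure_mono ?_)
  rw [smul_singleton]
  refine image_mono (Subset.trans (smul_set_subset_smul (inv_mem_inv.2 hg')) ?_)
  rw [V_symm]
  exact VU

/-! ### Derivatives of maps obeying group-like laws -/

section Analysis

variable {F : Type*} [NormedAddCommGroup F] [NormedSpace ℝ F]

theorem HasStrictFDerivAt.eq_fst_add_snd {f : F × F → F} {D : F × F →L[ℝ] F} {b : F}
    (hf : HasStrictFDerivAt f D (b, b)) (h₁ : ∀ᶠ ξ in 𝓝 b, f (ξ, b) = ξ)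
    (h₂ : ∀ᶠ ζ in 𝓝 b, f (b, ζ) = ζ) :
    D = ContinuousLinearMap.fst ℝ F F + ContinuousLinearMap.snd ℝ F F := by
  have e₁ : HasFDerivAt (fun ξ : F => f (ξ, b)) (D.comp (ContinuousLinearMap.inl ℝ F F)) b :=
    HasFDerivAt.comp (f := fun ξ : F => (ξ, b)) b hf.hasFDerivAt (hasFDerivAt_prodMk_left b b)
  have e₂ : HasFDerivAt (fun ζ : F => f (b, ζ)) (D.comp (ContinuousLinearMap.inr ℝ F F)) b :=
    HasFDerivAt.comp (f := fun ζ : F => (b, ζ)) b hf.hasFDerivAt (hasFDerivAt_prodMk_right b b)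
  have u₁ := e₁.unique ((hasFDerivAt_id b).congr_of_eventuallyEq h₁)
  have u₂ := e₂.unique ((hasFDerivAt_id b).congr_of_eventuallyEq h₂)
  ext v
  · simpa using congr($u₁ v)
  · simpa using congr($u₂ v)

theorem HasStrictFDerivAt.eq_snd_sub_fst {f : F × F → F} {D : F × F →L[ℝ] F} {b : F}
    (hf : HasStrictFDerivAt f D (b, b)) (h₁ : ∀ᶠ ξ in 𝓝 b, f (ξ, ξ) = b)
    (h₂ : ∀ᶠ ζ in 𝓝 b, f (b, ζ) = ζ) :
    D = ContinuousLinearMap.snd ℝ F F - ContinuousLinearMap.fst ℝ F F := by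
  have e₁ : HasFDerivAt (fun ξ : F => f (ξ, ξ))
      (D.comp ((ContinuousLinearMap.id ℝ F).prod (ContinuousLinearMap.id ℝ F))) b :=
    HasFDerivAt.comp (f := fun ξ : F => (ξ, ξ)) b hf.hasFDerivAt
      ((hasFDerivAt_id b).prodMk (hasFDerivAt_id b))
  have e₂ : HasFDerivAt (fun ζ : F => f (b, ζ)) (D.comp (ContinuousLinearMap.inr ℝ F F)) b :=
    HasFDerivAt.comp (f := fun ζ : F => (b, ζ)) b hf.hasFDerivAt (hasFDerivAt_prodMk_right b b)
  have u₁ := e₁.unique ((hasFDerivAt_const b b).congr_of_eventuallyEq h₁)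
  have u₂ := e₂.unique ((hasFDerivAt_id b).congr_of_eventuallyEq h₂)
  have key : ∀ v w : F, D (v, w) = w - v := by
    intro v w
    have a₁ : D (v, v) = 0 := by simpa using congr($u₁ v)
    have a₂ : D (0, w - v) = w - v := by simpa using congr($u₂ (w - v))
    -- The diagonal and the second axis span the product, and `D` is known on both.
    have : (v, w) = (v, v) + (0, w - v) := by ext <;> simp
    rw [this, map_add, a₁, a₂, zero_add]
  ext v <;> simp [key]

theorem eventually_forall_mem_closedBall_prod {X Y : Type*} [PseudoMetricSpace X]
    [PseudoMetricSpace Y] {a : X} {b : Y} {P : X × Y → Prop} (h : ∀ᶠ q in 𝓝 (a, b), P q) :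
    ∀ᶠ r in 𝓝[>] (0 : ℝ), ∀ ξ ∈ Metric.closedBall a r, ∀ ζ ∈ Metric.closedBall b r, P (ξ, ζ) := by
  obtain ⟨ε, hε, hP⟩ := Metric.eventually_nhds_iff.1 h
  filter_upwards [Ioo_mem_nhdsGT hε] with r hr ξ hξ ζ hζ
  exact hP ((max_le (Metric.mem_closedBall.1 hξ) (Metric.mem_closedBall.1 hζ)).trans_lt hr.2)

end Analysis

/-! ### Multiplication and action in charts -/

section Coordinates

variable {EG G E M : Type*} [NormedAddCommGroup EG] [NormedSpace ℝ EG]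
  [Group G] [TopologicalSpace G] [ChartedSpace EG G]
  [NormedAddCommGroup E] [NormedSpace ℝ E] [TopologicalSpace M] [ChartedSpace E M]
  [MulAction G M] [ContMDiffSMul 𝓘(ℝ, EG) 𝓘(ℝ, E) ∞ G M]
  {e : OpenPartialHomeomorph G EG} {c : OpenPartialHomeomorph M E}

theorem contDiffAt_smul_chart (he : e ∈ IsManifold.maximalAtlas 𝓘(ℝ, EG) ∞ G)
    (h1 : (1 : G) ∈ e.source) (hc : c ∈ IsManifold.maximalAtlas 𝓘(ℝ, E) ∞ M) {x : M}
    (hx : x ∈ c.source) :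
    ContDiffAt ℝ ∞ (fun p : EG × E => c (e.symm p.1 • c.symm p.2)) (e 1, c x) := by
  rw [← contMDiffAt_iff_contDiffAt]
  have hs : ContMDiffAt 𝓘(ℝ, EG) 𝓘(ℝ, EG) ∞ e.symm (e 1) :=
    contMDiffAt_symm_of_mem_maximalAtlas he (e.map_source h1)
  have hs' : ContMDiffAt 𝓘(ℝ, E) 𝓘(ℝ, E) ∞ c.symm (c x) :=
    contMDiffAt_symm_of_mem_maximalAtlas hc (c.map_source hx)
  have m : ContMDiffAt 𝓘(ℝ, EG × E) 𝓘(ℝ, E) ∞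
      (fun p : EG × E => e.symm p.1 • c.symm p.2) (e 1, c x) :=
    (hs.comp (e 1, c x) contDiff_fst.contMDiff.contMDiffAt).smul
      (hs'.comp (e 1, c x) contDiff_snd.contMDiff.contMDiffAt)
  refine ContMDiffAt.comp (e 1, c x) (contMDiffAt_of_mem_maximalAtlas hc ?_) m
  simpa [e.left_inv h1, c.left_inv hx] using hx

variable [LieGroup 𝓘(ℝ, EG) ∞ G]

theorem contDiffAt_mul_chart (he : e ∈ IsManifold.maximalAtlas 𝓘(ℝ, EG) ∞ G)
    (h1 : (1 : G) ∈ e.source) :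
    ContDiffAt ℝ ∞ (fun p : EG × EG => e (e.symm p.1 * e.symm p.2)) (e 1, e 1) := by
  rw [← contMDiffAt_iff_contDiffAt]
  have hs : ContMDiffAt 𝓘(ℝ, EG) 𝓘(ℝ, EG) ∞ e.symm (e 1) :=
    contMDiffAt_symm_of_mem_maximalAtlas he (e.map_source h1)
  have m : ContMDiffAt 𝓘(ℝ, EG × EG) 𝓘(ℝ, EG) ∞
      (fun p : EG × EG => e.symm p.1 * e.symm p.2) (e 1, e 1) :=
    (hs.comp (e 1, e 1) contDiff_fst.contMDiff.contMDiffAt).mul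
      (hs.comp (e 1, e 1) contDiff_snd.contMDiff.contMDiffAt)
  refine ContMDiffAt.comp (e 1, e 1) (contMDiffAt_of_mem_maximalAtlas he ?_) m
  simpa [e.left_inv h1] using h1

theorem contDiffAt_inv_mul_chart (he : e ∈ IsManifold.maximalAtlas 𝓘(ℝ, EG) ∞ G)
    (h1 : (1 : G) ∈ e.source) :
    ContDiffAt ℝ ∞ (fun p : EG × EG => e ((e.symm p.1)⁻¹ * e.symm p.2)) (e 1, e 1) := by
  rw [← contMDiffAt_iff_contDiffAt]
  have hs : ContMDiffAt 𝓘(ℝ, EG) 𝓘(ℝ, EG) ∞ e.symm (e 1) :=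
    contMDiffAt_symm_of_mem_maximalAtlas he (e.map_source h1)
  have m : ContMDiffAt 𝓘(ℝ, EG × EG) 𝓘(ℝ, EG) ∞
      (fun p : EG × EG => (e.symm p.1)⁻¹ * e.symm p.2) (e 1, e 1) :=
    (hs.comp (e 1, e 1) contDiff_fst.contMDiff.contMDiffAt).inv.mul
      (hs.comp (e 1, e 1) contDiff_snd.contMDiff.contMDiffAt)
  refine ContMDiffAt.comp (e 1, e 1) (contMDiffAt_of_mem_maximalAtlas he ?_) m
  simpa [e.left_inv h1] using h1

theorem hasStrictFDerivAt_mul_chart (he : e ∈ IsManifold.maximalAtlas 𝓘(ℝ, EG) ∞ G)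
    (h1 : (1 : G) ∈ e.source) :
    HasStrictFDerivAt (fun p : EG × EG => e (e.symm p.1 * e.symm p.2))
      (ContinuousLinearMap.fst ℝ EG EG + ContinuousLinearMap.snd ℝ EG EG) (e 1, e 1) := by
  have h := (contDiffAt_mul_chart he h1).hasStrictFDerivAt (by simp)
  have ht : ∀ᶠ ξ in 𝓝 (e 1), ξ ∈ e.target := e.open_target.mem_nhds (e.map_source h1)
  rwa [h.eq_fst_add_snd] at h
  · filter_upwards [ht] with ξ hξ
    simp [e.left_inv h1, e.right_inv hξ]
  · filter_upwards [ht] with ξ hξ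
    simp [e.left_inv h1, e.right_inv hξ]

theorem hasStrictFDerivAt_inv_mul_chart (he : e ∈ IsManifold.maximalAtlas 𝓘(ℝ, EG) ∞ G)
    (h1 : (1 : G) ∈ e.source) :
    HasStrictFDerivAt (fun p : EG × EG => e ((e.symm p.1)⁻¹ * e.symm p.2))
      (ContinuousLinearMap.snd ℝ EG EG - ContinuousLinearMap.fst ℝ EG EG) (e 1, e 1) := by
  have h := (contDiffAt_inv_mul_chart he h1).hasStrictFDerivAt (by simp)
  have ht : ∀ᶠ ξ in 𝓝 (e 1), ξ ∈ e.target := e.open_target.mem_nhds (e.map_source h1)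
  rwa [h.eq_snd_sub_fst] at h
  · filter_upwards [ht] with ξ hξ
    simp
  · filter_upwards [ht] with ξ hξ
    simp [e.left_inv h1, e.right_inv hξ]

/-- In a chart at the identity, multiplication is addition up to a small relative error. -/
theorem exists_ball_norm_mul_chart_sub_le (he : e ∈ IsManifold.maximalAtlas 𝓘(ℝ, EG) ∞ G)
    (h1 : (1 : G) ∈ e.source) {η : ℝ} (hη : 0 < η) :
    ∀ᶠ r in 𝓝[>] (0 : ℝ), ∀ ξ ∈ Metric.closedBall (e 1) r, ∀ ζ ∈ Metric.closedBall (e 1) r,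
      e.symm ξ * e.symm ζ ∈ e.source ∧
        ‖e (e.symm ξ * e.symm ζ) - ξ - (ζ - e 1)‖ ≤ η * ‖ζ - e 1‖ := by
  apply eventually_forall_mem_closedBall_prod
    (P := fun q : EG × EG => e.symm q.1 * e.symm q.2 ∈ e.source ∧
      ‖e (e.symm q.1 * e.symm q.2) - q.1 - (q.2 - e 1)‖ ≤ η * ‖q.2 - e 1‖)
  have := topologicalGroup_of_lieGroup 𝓘(ℝ, EG) ∞ (G := G)
  have ht := e.map_source h1
  have hsrc : ∀ᶠ q in 𝓝 (e 1, e 1), e.symm q.1 * e.symm q.2 ∈ e.source := by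
    have hs := e.continuousAt_symm ht
    have : ContinuousAt (fun q : EG × EG => e.symm q.1 * e.symm q.2) (e 1, e 1) :=
      (ContinuousAt.comp (f := Prod.fst) hs continuousAt_fst).mul
        (ContinuousAt.comp (f := Prod.snd) hs continuousAt_snd)
    refine this.eventually_mem (e.open_source.mem_nhds ?_)
    simpa [e.left_inv h1] using h1
  have hD := (hasStrictFDerivAt_mul_chart he h1).isLittleO.def hη
  -- Strict differentiability is applied to two points sharing the first coordinate, so the error is
  -- relative to the second factor alone. This lets errors add up only linearly when powers are
  -- formed.
  have hc : Tendsto (fun q : EG × EG => (q, (q.1, e 1))) (𝓝 (e 1, e 1))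
      (𝓝 ((e 1, e 1), (e 1, e 1))) :=
    Continuous.tendsto' (by fun_prop) _ _ rfl
  have htgt : ∀ᶠ q : EG × EG in 𝓝 (e 1, e 1), q.1 ∈ e.target :=
    continuousAt_fst.eventually_mem (e.open_target.mem_nhds ht)
  filter_upwards [hsrc, hc.eventually hD, htgt] with q h₁ h₂ h₃
  refine ⟨h₁, ?_⟩
  simpa [e.left_inv h1, e.right_inv h₃, Prod.norm_def] using h₂

/-- Since a⁻¹b is b − a to first order, this compares elements having the same image of the base
point, where a⁻¹b is in the isotropy group. It is not iterated, so an error relative to both factors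
is enough. -/
theorem exists_ball_norm_inv_mul_chart_sub_le (he : e ∈ IsManifold.maximalAtlas 𝓘(ℝ, EG) ∞ G)
    (h1 : (1 : G) ∈ e.source) {η : ℝ} (hη : 0 < η) :
    ∀ᶠ r in 𝓝[>] (0 : ℝ), ∀ ξ ∈ Metric.closedBall (e 1) r, ∀ ζ ∈ Metric.closedBall (e 1) r,
      (e.symm ξ)⁻¹ * e.symm ζ ∈ e.source ∧
        ‖e ((e.symm ξ)⁻¹ * e.symm ζ) - e 1 - (ζ - ξ)‖ ≤ η * (‖ξ - e 1‖ + ‖ζ - e 1‖) := by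
  apply eventually_forall_mem_closedBall_prod
    (P := fun q : EG × EG => (e.symm q.1)⁻¹ * e.symm q.2 ∈ e.source ∧
      ‖e ((e.symm q.1)⁻¹ * e.symm q.2) - e 1 - (q.2 - q.1)‖ ≤ η * (‖q.1 - e 1‖ + ‖q.2 - e 1‖))
  have := topologicalGroup_of_lieGroup 𝓘(ℝ, EG) ∞ (G := G)
  have ht := e.map_source h1
  have hsrc : ∀ᶠ q in 𝓝 (e 1, e 1), (e.symm q.1)⁻¹ * e.symm q.2 ∈ e.source := by
    have hs := e.continuousAt_symm ht
    have : ContinuousAt (fun q : EG × EG => (e.symm q.1)⁻¹ * e.symm q.2) (e 1, e 1) :=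
      (ContinuousAt.comp (f := Prod.fst) hs continuousAt_fst).inv.mul
        (ContinuousAt.comp (f := Prod.snd) hs continuousAt_snd)
    refine this.eventually_mem (e.open_source.mem_nhds ?_)
    simpa [e.left_inv h1] using h1
  have hD := (hasStrictFDerivAt_inv_mul_chart he h1).isLittleO.def hη
  have hc : Tendsto (fun q : EG × EG => (q, (e 1, e 1))) (𝓝 (e 1, e 1))
      (𝓝 ((e 1, e 1), (e 1, e 1))) :=
    Continuous.tendsto' (by fun_prop) _ _ rfl
  filter_upwards [hsrc, hc.eventually hD] with q h₁ h₂
  refine ⟨h₁, ?_⟩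
  have h₃ : ‖q - (e 1, e 1)‖ ≤ ‖q.1 - e 1‖ + ‖q.2 - e 1‖ :=
    max_le (le_add_of_nonneg_right (norm_nonneg _)) (le_add_of_nonneg_left (norm_nonneg _))
  refine le_trans ?_ (h₂.trans (mul_le_mul_of_nonneg_left h₃ hη.le))
  simp [e.left_inv h1]

omit [LieGroup 𝓘(ℝ, EG) ∞ G] in
/-- Near the identity, the action is uniformly Lipschitz in a chart. -/
theorem exists_norm_smul_chart_sub_le (he : e ∈ IsManifold.maximalAtlas 𝓘(ℝ, EG) ∞ G)
    (h1 : (1 : G) ∈ e.source) (hc : c ∈ IsManifold.maximalAtlas 𝓘(ℝ, E) ∞ M) {x : M}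
    (hx : x ∈ c.source) :
    ∃ C > 0, ∃ N ∈ 𝓝 (1 : G), ∃ W ∈ 𝓝 x, W ⊆ c.source ∧ ∀ a ∈ N, ∀ z ∈ W, ∀ w ∈ W,
      a • z ∈ c.source ∧ ‖c (a • z) - c (a • w)‖ ≤ C * ‖c z - c w‖ := by
  obtain ⟨K, t, ht, hK⟩ :=
    -- A C¹ map is locally Lipschitz; with the group element held fixed, only the chart distance of
    -- the two points remains.
    ((contDiffAt_smul_chart he h1 hc hx).of_le (by simp)).exists_lipschitzOnWith
  have := ContMDiffSMul.continuousSMul (I := 𝓘(ℝ, EG)) (I' := 𝓘(ℝ, E)) (G := G) (M := M) ∞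
  have he1 := e.continuousAt h1
  have hcx := c.continuousAt hx
  have h₁ : ∀ᶠ p : G × M in 𝓝 (1, x), (e p.1, c p.2) ∈ t :=
    (ContinuousAt.prodMap' he1 hcx).eventually_mem ht
  have h₂ : ∀ᶠ p : G × M in 𝓝 (1, x), p.1 • p.2 ∈ c.source :=
    (continuous_smul.continuousAt (x := ((1 : G), x))).eventually_mem
      (c.open_source.mem_nhds (by simpa using hx))
  have h₃ : ∀ᶠ p : G × M in 𝓝 (1, x), p.1 ∈ e.source ∧ p.2 ∈ c.source :=
    prod_mem_nhds (e.open_source.mem_nhds h1) (c.open_source.mem_nhds hx)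
  obtain ⟨N, hN, W, hW, hNW⟩ := mem_nhds_prod_iff.1 (h₁.and (h₂.and h₃))
  refine ⟨K + 1, by positivity, N, hN, W, hW,
    fun z hz => (hNW (mk_mem_prod (mem_of_mem_nhds hN) hz)).2.2.2, fun a ha z hz w hw => ?_⟩
  obtain ⟨z₁, z₂, z₃, z₄⟩ := hNW (mk_mem_prod ha hz)
  obtain ⟨w₁, w₂, w₃, w₄⟩ := hNW (mk_mem_prod ha hw)
  refine ⟨z₂, ?_⟩
  have := hK.norm_sub_le z₁ w₁
  simp only [e.left_inv z₃, c.left_inv z₄, c.left_inv w₄] at z₄ w₄ this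
  refine this.trans ?_
  simp only [Prod.mk_sub_mk, sub_self, Prod.norm_mk, norm_zero, norm_nonneg, sup_of_le_right]
  gcongr
  simp

end Coordinates

theorem OpenPartialHomeomorph.exists_forall_norm_sub_lt {E M : Type*} [NormedAddCommGroup E]
    [TopologicalSpace M] (c : OpenPartialHomeomorph M E) {x : M} (hx : x ∈ c.source) {S : Set M}
    (hS : S ∈ 𝓝 x) : ∃ δ > 0, ∀ y ∈ c.source, ‖c y - c x‖ < δ → y ∈ S := by
  have h := c.continuousAt_symm (c.map_source hx)
  rw [ContinuousAt, c.left_inv hx] at h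
  obtain ⟨δ, hδ, hδS⟩ := Metric.eventually_nhds_iff_ball.1 (h.eventually_mem hS)
  refine ⟨δ, hδ, fun y hy hyx => ?_⟩
  simpa [c.left_inv hy] using hδS (c y) (by rwa [mem_ball_iff_norm])

/-! ### Open mapping theorem for orbit maps -/

section OpenOrbit

variable {EG G E M : Type*} [NormedAddCommGroup EG] [NormedSpace ℝ EG] [CompleteSpace EG]
  [Group G] [TopologicalSpace G] [ChartedSpace EG G] [LieGroup 𝓘(ℝ, EG) ∞ G]
  [SecondCountableTopology G]
  [NormedAddCommGroup E] [NormedSpace ℝ E] [CompleteSpace E]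
  [TopologicalSpace M] [ChartedSpace E M]
  [MulAction G M] [ContMDiffSMul 𝓘(ℝ, EG) 𝓘(ℝ, E) ∞ G M] [MulAction.IsPretransitive G M]
  {e : OpenPartialHomeomorph G EG} {c : OpenPartialHomeomorph M E}

/-- Open mapping theorem for orbit maps of transitive smooth actions of separable Banach Lie
groups. -/
theorem image_smul_mem_nhds (he : e ∈ IsManifold.maximalAtlas 𝓘(ℝ, EG) ∞ G)
    (h1 : (1 : G) ∈ e.source) (hc : c ∈ IsManifold.maximalAtlas 𝓘(ℝ, E) ∞ M) {x : M}
    (hx : x ∈ c.source) {U : Set G} (hU : U ∈ 𝓝 (1 : G)) :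
    (fun a : G => a • x) '' U ∈ 𝓝 x := by
  have := topologicalGroup_of_lieGroup 𝓘(ℝ, EG) ∞ (G := G)
  have := ContMDiffSMul.continuousSMul (I := 𝓘(ℝ, EG)) (I' := 𝓘(ℝ, E)) (G := G) (M := M) ∞
  have := ChartedSpace.baireSpace E M
  obtain ⟨C, hC, N, hN, W, hW, hWc, hNW⟩ := exists_norm_smul_chart_sub_le he h1 hc hx
  have ht := e.map_source h1
  -- the radius in which the approximation takes place
  have hgood : ∀ᶠ a in 𝓝 (1 : G), a ∈ U ∧ a⁻¹ ∈ N ∧ a • x ∈ W := by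
    refine (eventually_mem_set.2 hU).and (Eventually.and ?_ ?_)
    · exact continuousAt_inv.eventually_mem (by simpa using hN)
    · exact ((continuous_id.smul continuous_const).continuousAt (x := (1 : G))).eventually_mem
        (by simpa using hW)
  have hgood' : ∀ᶠ ξ in 𝓝 (e 1), ξ ∈ e.target ∧
      (e.symm ξ ∈ U ∧ (e.symm ξ)⁻¹ ∈ N ∧ e.symm ξ • x ∈ W) := by
    refine (eventually_mem_set.2 (e.open_target.mem_nhds ht)).and ?_
    refine (e.continuousAt_symm ht).eventually
      (p := fun a => a ∈ U ∧ a⁻¹ ∈ N ∧ a • x ∈ W) ?_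
    rwa [e.left_inv h1]
  obtain ⟨r, hr, hrmul, hrgood⟩ : ∃ r > (0 : ℝ),
      (∀ ξ ∈ Metric.closedBall (e 1) r, ∀ ζ ∈ Metric.closedBall (e 1) r,
      e.symm ξ * e.symm ζ ∈ e.source ∧
        ‖e (e.symm ξ * e.symm ζ) - ξ - (ζ - e 1)‖ ≤ 1 * ‖ζ - e 1‖) ∧
      ∀ ξ ∈ Metric.closedBall (e 1) r, ξ ∈ e.target ∧
        (e.symm ξ ∈ U ∧ (e.symm ξ)⁻¹ ∈ N ∧ e.symm ξ • x ∈ W) := by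
    obtain ⟨ε, hε, hεg⟩ := Metric.eventually_nhds_iff_ball.1 hgood'
    obtain ⟨r, h₁, h₂⟩ := ((exists_ball_norm_mul_chart_sub_le he h1 one_pos).and
      (Ioo_mem_nhdsGT hε)).exists
    exact ⟨r, h₂.1, h₁, fun ξ hξ => hεg ξ (Metric.closedBall_subset_ball h₂.2 hξ)⟩
  -- neighbourhoods of `x` contained in the closures of small pieces of the orbit
  have hρ : ∀ n : ℕ, ∃ ρ > 0, ρ ≤ (1 / 2 : ℝ) ^ n ∧ ∀ z ∈ c.source, ‖c z - c x‖ < ρ →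
      z ∈ closure ((fun a : G => a • x) ''
        (e.symm '' Metric.closedBall (e 1) (r / 8 * (1 / 2) ^ n))) := by
    intro n
    have hV : e.symm '' Metric.closedBall (e 1) (r / 8 * (1 / 2) ^ n) ∈ 𝓝 (1 : G) := by
      have := e.symm.image_mem_nhds (by simpa using ht)
        (Metric.closedBall_mem_nhds (e 1) (ε := r / 8 * (1 / 2) ^ n) (by positivity))
      rwa [e.left_inv h1] at this
    have hcl := closure_image_smul_mem_nhds hV x
    obtain ⟨ε, hε, hεs⟩ := c.exists_forall_norm_sub_lt hx hcl
    exact ⟨min ε ((1 / 2) ^ n), lt_min hε (by positivity), min_le_right _ _,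
      fun z hz hzx => hεs z hz (hzx.trans_le (min_le_left _ _))⟩
  choose ρ hρ0 hρle hρcl using hρ
  have hyev : ∀ᶠ y in 𝓝 x, y ∈ W ∧ ‖c y - c x‖ < ρ 0 / C := by
    refine (eventually_mem_set.2 hW).and ?_
    have : ContinuousAt (fun y => ‖c y - c x‖) x :=
      ((c.continuousAt hx).sub continuousAt_const).norm
    exact this.eventually_lt_const (by simpa using div_pos (hρ0 0) hC)
  filter_upwards [hyev] with y hy
  -- As in the open mapping theorem, `y` is approximated by orbit points with coordinates `ξ n`. The
  -- steps `r / 4 * (1 / 2) ^ n` sum to `r / 2`, and `ρ n ≤ (1 / 2) ^ n` makes the remaining error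
  -- vanish in the limit.
  let Inv : ℕ → EG → Prop := fun n ξ =>
    ‖ξ - e 1‖ ≤ r / 2 * (1 - (1 / 2) ^ n) ∧ ‖c y - c (e.symm ξ • x)‖ < ρ n / C
  have hball : ∀ n ξ, Inv n ξ → ξ ∈ Metric.closedBall (e 1) (r / 2) := by
    intro n ξ h
    rw [mem_closedBall_iff_norm]
    refine h.1.trans ?_
    have : (0 : ℝ) ≤ (1 / 2) ^ n := by positivity
    nlinarith
  have hsub : Metric.closedBall (e 1) (r / 2) ⊆ Metric.closedBall (e 1) r :=
    Metric.closedBall_subset_closedBall (by linarith)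
  have hstep : ∀ n ξ, Inv n ξ → ∃ ξ', Inv (n + 1) ξ' ∧ ‖ξ' - ξ‖ ≤ r / 4 * (1 / 2) ^ n := by
    intro n ξ h
    have hξr := hsub (hball n ξ h)
    obtain ⟨hξt, hξU, hξN, hξW⟩ := hrgood ξ hξr
    set a := e.symm ξ
    -- Pulling back by `a⁻¹` costs a factor `C`, so error below `ρ n / C` puts `a⁻¹ • y` within `ρ
    -- n` of `x`, where the `n`-th small orbit piece is dense.
    obtain ⟨hzs, hz⟩ := hNW a⁻¹ hξN y hy.1 (a • x) hξW
    have hzcl := hρcl n (a⁻¹ • y) hzs (by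
      rw [inv_smul_smul] at hz
      refine hz.trans_lt ?_
      have := (lt_div_iff₀ hC).1 h.2
      linarith)
    have hev : ∀ᶠ z in 𝓝 (a⁻¹ • y), ‖c y - c (a • z)‖ < ρ (n + 1) / C := by
      have hcont : ContinuousAt (fun z => ‖c y - c (a • z)‖) (a⁻¹ • y) := by
        refine (continuousAt_const.sub (ContinuousAt.comp (f := fun z => a • z) ?_
          (continuous_const_smul a).continuousAt)).norm
        rw [smul_inv_smul]
        exact c.continuousAt (hWc hy.1)
      refine hcont.eventually_lt_const ?_
      simpa using div_pos (hρ0 (n + 1)) hC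
    obtain ⟨_, hz1, _, ⟨ζ, hζ, rfl⟩, rfl⟩ := mem_closure_iff_nhds.1 hzcl _ hev
    have hp : (0 : ℝ) < (1 / 2) ^ n := by positivity
    have hp1 : (1 / 2 : ℝ) ^ n ≤ 1 := pow_le_one₀ (by norm_num) (by norm_num)
    have hζr : ζ ∈ Metric.closedBall (e 1) r :=
      Metric.closedBall_subset_closedBall (by nlinarith) hζ
    obtain ⟨hsrc, hm⟩ := hrmul ξ hξr ζ hζr
    rw [mem_closedBall_iff_norm] at hζ
    -- Multiplication with relative error 1 at most doubles the increment, which is why the pieces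
    -- have radius `r / 8 * (1 / 2) ^ n`.
    have hd : ‖e (a * e.symm ζ) - ξ‖ ≤ r / 4 * (1 / 2) ^ n := by
      have : e (a * e.symm ζ) - ξ = (e (a * e.symm ζ) - ξ - (ζ - e 1)) + (ζ - e 1) := by abel
      rw [this]
      refine (norm_add_le _ _).trans ?_
      linarith
    refine ⟨e (a * e.symm ζ), ⟨?_, ?_⟩, hd⟩
    · have : e (a * e.symm ζ) - e 1 = (e (a * e.symm ζ) - ξ) + (ξ - e 1) := by abel
      rw [this]
      refine (norm_add_le _ _).trans ?_
      have h0 := h.1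
      rw [pow_succ]
      linarith
    · rw [e.left_inv hsrc, mul_smul]
      exact hz1
  have hInv0 : Inv 0 (e 1) := by simpa [Inv, e.left_inv h1] using hy.2
  choose! step hstep₁ hstep₂ using hstep
  let ξ : ℕ → EG := fun n => Nat.rec (e 1) (fun n η => step n η) n
  have hξ : ∀ n, Inv n (ξ n) := by
    intro n
    induction n with
    | zero => exact hInv0
    | succ n ih => exact hstep₁ n _ ih
  have hcau : CauchySeq ξ := by
    refine cauchySeq_of_le_geometric (1 / 2) (r / 4) (by norm_num) fun n => ?_
    rw [dist_comm, dist_eq_norm]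
    exact hstep₂ n _ (hξ n)
  obtain ⟨ξ', hξ'⟩ := cauchySeq_tendsto_of_complete hcau
  have hξ'r : ξ' ∈ Metric.closedBall (e 1) r :=
    hsub (Metric.isClosed_closedBall.mem_of_tendsto hξ'
      (Eventually.of_forall fun n => hball n _ (hξ n)))
  obtain ⟨h₁, h₂, h₃, h₄⟩ := hrgood ξ' hξ'r
  refine ⟨e.symm ξ', h₂, ?_⟩
  apply c.injOn (hWc h₄) (hWc hy.1)
  have hlim : Tendsto (fun n => c (e.symm (ξ n) • x)) atTop (𝓝 (c (e.symm ξ' • x))) := by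
    refine (c.continuousAt (hWc h₄)).tendsto.comp ?_
    exact (((e.continuousAt_symm h₁).tendsto.comp hξ').smul_const x)
  refine tendsto_nhds_unique hlim ?_
  rw [tendsto_iff_norm_sub_tendsto_zero]
  refine squeeze_zero (fun _ => norm_nonneg _) (g := fun n => (1 / 2 : ℝ) ^ n / C) (fun n => ?_) ?_
  · rw [norm_sub_rev]
    refine (hξ n).2.le.trans ?_
    have := hρle n
    gcongr
  · simpa using (tendsto_pow_atTop_nhds_zero_of_lt_one (by norm_num : (0 : ℝ) ≤ 1 / 2)
      (by norm_num)).div_const C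

end OpenOrbit

/-! ### Orbit maps are submersions -/

section Submersion

variable {EG G E M : Type*} [NormedAddCommGroup EG] [NormedSpace ℝ EG] [CompleteSpace EG]
  [Group G] [TopologicalSpace G] [ChartedSpace EG G] [LieGroup 𝓘(ℝ, EG) ∞ G]
  [SecondCountableTopology G]
  [NormedAddCommGroup E] [NormedSpace ℝ E] [CompleteSpace E]
  [TopologicalSpace M] [ChartedSpace E M]
  [MulAction G M] [ContMDiffSMul 𝓘(ℝ, EG) 𝓘(ℝ, E) ∞ G M] [MulAction.IsPretransitive G M]
  {e : OpenPartialHomeomorph G EG} {c : OpenPartialHomeomorph M E}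

/-- The orbit map is open at the identity already when restricted to a slice complementary to the
isotropy group. -/
theorem eventually_exists_slice_smul_eq (he : e ∈ IsManifold.maximalAtlas 𝓘(ℝ, EG) ∞ G)
    (h1 : (1 : G) ∈ e.source) (hc : c ∈ IsManifold.maximalAtlas 𝓘(ℝ, E) ∞ M) {x : M}
    (hx : x ∈ c.source) {Q : EG →L[ℝ] EG} (hQ : ∀ v, Q (Q v) = Q v)
    (hH : ∀ a ∈ e.source, Q (e a - e 1) = 0 → a • x = x) {ε : ℝ} (hε : 0 < ε) :
    ∀ᶠ y in 𝓝 x, ∃ m, Q m = m ∧ ‖m‖ < ε ∧ e.symm (e 1 + m) • x = y := by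
  have := topologicalGroup_of_lieGroup 𝓘(ℝ, EG) ∞ (G := G)
  have ht := e.map_source h1
  -- The first factor is put in the slice, the range of `Q`, and the second in the isotropy
  -- directions, its kernel. The product map has derivative `(p₁, p₂) ↦ Q p₁ + (p₂ - Q p₂)`, onto
  -- because `(v, v) ↦ v`. So elements near 1 factor as slice times isotropy, and the isotropy
  -- factor does not move `x`.
  let A : EG × EG →L[ℝ] EG × EG :=
    Q.prodMap (ContinuousLinearMap.id ℝ EG - Q)
  let j : EG × EG → EG × EG := fun p => (e 1, e 1) + A p
  have hj0 : j 0 = (e 1, e 1) := by simp [j]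
  have hj : HasStrictFDerivAt j A 0 := A.hasStrictFDerivAt.const_add _
  let f : EG × EG → EG := fun p => e (e.symm (j p).1 * e.symm (j p).2)
  have hf : HasStrictFDerivAt f
      ((ContinuousLinearMap.fst ℝ EG EG + ContinuousLinearMap.snd ℝ EG EG).comp A) 0 := by
    refine HasStrictFDerivAt.comp
      (g := fun p : EG × EG => e (e.symm p.1 * e.symm p.2)) (f := j) 0 ?_ hj
    rw [hj0]
    exact hasStrictFDerivAt_mul_chart he h1
  have hf0 : f 0 = e 1 := by simp [f, hj0, e.left_inv h1]
  have hmap := hf.map_nhds_eq_of_surj (by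
    rw [LinearMap.range_eq_top]
    intro v
    exact ⟨(v, v), by simp [A]⟩)
  rw [hf0] at hmap
  let T : Set (EG × EG) := {p | ‖Q p.1‖ < ε ∧ (j p).1 ∈ e.target ∧ (j p).2 ∈ e.target ∧
    e.symm (j p).1 * e.symm (j p).2 ∈ e.source}
  have hT : T ∈ 𝓝 (0 : EG × EG) := by
    have hjc : ContinuousAt j 0 := hj.continuousAt
    have k₁ : ContinuousAt (fun p => (j p).1) 0 := hjc.fst
    have k₂ : ContinuousAt (fun p => (j p).2) 0 := hjc.snd
    have e₁ : ContinuousAt (fun p => e.symm (j p).1) 0 :=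
      ContinuousAt.comp (f := fun p => (j p).1) (g := e.symm)
        (by simpa [hj0] using e.continuousAt_symm ht) k₁
    have e₂ : ContinuousAt (fun p => e.symm (j p).2) 0 :=
      ContinuousAt.comp (f := fun p => (j p).2) (g := e.symm)
        (by simpa [hj0] using e.continuousAt_symm ht) k₂
    have q₁ : ContinuousAt (fun p : EG × EG => ‖Q p.1‖) 0 := by fun_prop
    refine (q₁.eventually_lt_const (by simpa using hε)).and ((k₁.eventually_mem ?_).and
      ((k₂.eventually_mem ?_).and ((e₁.mul e₂).eventually_mem ?_)))
    · simpa [hj0] using e.open_target.mem_nhds ht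
    · simpa [hj0] using e.open_target.mem_nhds ht
    · simpa [hj0, e.left_inv h1] using e.open_source.mem_nhds h1
  have hU : e.symm '' (f '' T) ∈ 𝓝 (1 : G) := by
    have := e.symm.image_mem_nhds (by simpa using ht) (hmap ▸ image_mem_map hT)
    rwa [e.left_inv h1] at this
  filter_upwards [image_smul_mem_nhds he h1 hc hx hU] with y hy
  obtain ⟨_, ⟨_, ⟨p, ⟨p₁, p₂, p₃, p₄⟩, rfl⟩, rfl⟩, rfl⟩ := hy
  refine ⟨Q p.1, hQ _, p₁, ?_⟩
  have hfix : e.symm (j p).2 • x = x := by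
    apply hH _ (e.map_target p₃)
    rw [e.right_inv p₃]
    simp [j, A, hQ]
  change _ = e.symm (e (e.symm (j p).1 * e.symm (j p).2)) • x
  rw [e.left_inv p₄, mul_smul, hfix]
  rfl

/-- Along a slice complementary to the isotropy group, the orbit map has a Lipschitz inverse at the
base point. -/
theorem exists_norm_le_norm_slice_smul_sub (he : e ∈ IsManifold.maximalAtlas 𝓘(ℝ, EG) ∞ G)
    (h1 : (1 : G) ∈ e.source) (hc : c ∈ IsManifold.maximalAtlas 𝓘(ℝ, E) ∞ M) {x : M}
    (hx : x ∈ c.source) {Q : EG →L[ℝ] EG} (hQ : ∀ v, Q (Q v) = Q v)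
    (hH : ∀ a ∈ e.source, Q (e a - e 1) = 0 ↔ a • x = x) :
    ∃ C > 0, ∀ᶠ m in 𝓝 (0 : EG), Q m = m → ‖m‖ ≤ C * ‖c (e.symm (e 1 + m) • x) - c x‖ := by
  have := topologicalGroup_of_lieGroup 𝓘(ℝ, EG) ∞ (G := G)
  have := ContMDiffSMul.continuousSMul (I := 𝓘(ℝ, EG)) (I' := 𝓘(ℝ, E)) (G := G) (M := M) ∞
  have ht := e.map_source h1
  obtain ⟨C, hC, N, hN, W, hW, hWc, hNW⟩ := exists_norm_smul_chart_sub_le he h1 hc hx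
  -- The value 1/16 keeps the errors, after applying `Q`, too small to bridge the gap between ‖m'‖ <
  -- ρ / 8 and k‖m‖ > ρ / 2 in the final contradiction.
  obtain ⟨η, hη, hη1, hηQ⟩ : ∃ η > (0 : ℝ), η ≤ 1 ∧ ‖Q‖ * η ≤ 1 / 16 := by
    refine ⟨1 / (16 * (‖Q‖ + 1)), by positivity, ?_, ?_⟩
    · rw [div_le_one (by positivity)]
      linarith [norm_nonneg Q]
    · rw [mul_one_div, div_le_div_iff₀ (by positivity) (by positivity)]
      linarith
  have hgood : ∀ᶠ ξ in 𝓝 (e 1), ξ ∈ e.target ∧ e.symm ξ ∈ N := by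
    refine (eventually_mem_set.2 (e.open_target.mem_nhds ht)).and ?_
    refine (e.continuousAt_symm ht).eventually_mem ?_
    rwa [e.left_inv h1]
  obtain ⟨ε, hε, hεg⟩ := Metric.eventually_nhds_iff_ball.1 hgood
  obtain ⟨r, ⟨hrmul, hrinv⟩, hr, hrε⟩ := (((exists_ball_norm_mul_chart_sub_le he h1 hη).and
    (exists_ball_norm_inv_mul_chart_sub_le he h1 hη)).and (Ioo_mem_nhdsGT hε)).exists
  have hrgood : ∀ ξ ∈ Metric.closedBall (e 1) r, ξ ∈ e.target ∧ e.symm ξ ∈ N :=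
    fun ξ hξ => hεg ξ (Metric.closedBall_subset_ball hrε hξ)
  obtain ⟨ρ, hρ, rfl⟩ : ∃ ρ > 0, r = 2 * ρ := ⟨r / 2, by positivity, by ring⟩
  obtain ⟨δ, hδ, hδs⟩ := c.exists_forall_norm_sub_lt hx (eventually_exists_slice_smul_eq he h1 hc hx
    hQ (fun a ha h => (hH a ha).1 h) (ε := ρ / 8) (by positivity))
  refine ⟨C * ρ / δ, by positivity, ?_⟩
  have hmW : ∀ᶠ m in 𝓝 (0 : EG), e.symm (e 1 + m) • x ∈ W := by
    have k₁ : ContinuousAt (fun m => e.symm (e 1 + m)) 0 :=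
      ContinuousAt.comp (f := fun m => e 1 + m) (g := e.symm)
        (by simpa using e.continuousAt_symm ht) (by fun_prop)
    refine (k₁.smul continuousAt_const).eventually_mem ?_
    simpa [e.left_inv h1] using hW
  have hmρ : ∀ᶠ m in 𝓝 (0 : EG), ‖m‖ < ρ / 2 :=
    continuous_norm.continuousAt.eventually_lt_const (by simpa using hρ)
  filter_upwards [hmW, hmρ] with m hmW hmρ hmQ
  rcases eq_or_ne m 0 with rfl | hm0
  · simp [e.left_inv h1]
  have hmpos : 0 < ‖m‖ := norm_pos_iff.2 hm0
  set a := e.symm (e 1 + m) with ha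
  set d := ‖c (a • x) - c x‖ with hd
  -- The number of powers after which `k • m` has size between ρ / 2 and ρ; the lower bound uses ‖m‖
  -- < ρ / 2.
  let k := ⌊ρ / ‖m‖⌋₊
  have hk₁ : k * ‖m‖ ≤ ρ := (le_div_iff₀ hmpos).1 (Nat.floor_le (by positivity))
  have hk₂ : ρ / 2 < k * ‖m‖ := by
    have := (div_lt_iff₀ hmpos).1 (Nat.lt_floor_add_one (ρ / ‖m‖))
    change ρ < (k + 1) * ‖m‖ at this
    linarith
  have hjk : ∀ j : ℕ, j ≤ k → j * ‖m‖ ≤ ρ := fun j hj => by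
    have : (j : ℝ) ≤ k := by exact_mod_cast hj
    nlinarith
  have hmball : e 1 + m ∈ Metric.closedBall (e 1) (2 * ρ) := by
    rw [mem_closedBall_iff_norm, add_sub_cancel_left]
    linarith
  have hnear : ∀ j : ℕ, j ≤ k → ‖e (a ^ j) - e 1 - (j : ℝ) • m‖ ≤ η * (j * ‖m‖) →
      ‖e (a ^ j) - e 1‖ ≤ 2 * ρ := fun j hj h => by
    have h' : e (a ^ j) - e 1 = (e (a ^ j) - e 1 - (j : ℝ) • m) + (j : ℝ) • m := by abel
    rw [h']
    refine (norm_add_le _ _).trans ?_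
    rw [norm_smul, Real.norm_natCast]
    have := hjk j hj
    have hnn : 0 ≤ j * ‖m‖ := by positivity
    nlinarith
  -- In the chart `a ^ j` is `j • m`, with error η‖m‖ per multiplication.
  have hpow : ∀ j : ℕ, j ≤ k →
      a ^ j ∈ e.source ∧ ‖e (a ^ j) - e 1 - (j : ℝ) • m‖ ≤ η * (j * ‖m‖) := by
    intro j
    induction j with
    | zero => simp [h1]
    | succ j ih =>
      intro hj
      obtain ⟨ih₁, ih₂⟩ := ih (by omega)
      obtain ⟨s₁, s₂⟩ := hrmul (e (a ^ j))
        (mem_closedBall_iff_norm.2 (hnear j (by omega) ih₂)) _ hmball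
      rw [e.left_inv ih₁, ← ha, ← pow_succ, add_sub_cancel_left] at s₂
      rw [e.left_inv ih₁, ← ha, ← pow_succ] at s₁
      refine ⟨s₁, ?_⟩
      have h' : e (a ^ (j + 1)) - e 1 - ((j + 1 : ℕ) : ℝ) • m =
          (e (a ^ (j + 1)) - e (a ^ j) - m) + (e (a ^ j) - e 1 - (j : ℝ) • m) := by
        push_cast
        module
      rw [h']
      refine (norm_add_le _ _).trans ?_
      push_cast
      linarith
  -- Telescoping: `a ^ j` maps the pair `a • x`, `x` to consecutive orbit points, expanding their
  -- distance `d` by at most `C`.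
  have hdisp : ∀ j : ℕ, j ≤ k →
      a ^ j • x ∈ c.source ∧ ‖c (a ^ j • x) - c x‖ ≤ C * (j * d) := by
    intro j
    induction j with
    | zero => simp [hx]
    | succ j ih =>
      intro hj
      obtain ⟨ih₁, ih₂⟩ := ih (by omega)
      obtain ⟨s₁, s₂⟩ := hpow j (by omega)
      have hN' : a ^ j ∈ N := by
        have := (hrgood (e (a ^ j)) (mem_closedBall_iff_norm.2 (hnear j (by omega) s₂))).2
        rwa [e.left_inv s₁] at this
      obtain ⟨u₁, u₂⟩ := hNW _ hN' _ hmW x (mem_of_mem_nhds hW)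
      rw [smul_smul, ← pow_succ] at u₁ u₂
      refine ⟨u₁, ?_⟩
      have h' : c (a ^ (j + 1) • x) - c x =
          (c (a ^ (j + 1) • x) - c (a ^ j • x)) + (c (a ^ j • x) - c x) := by abel
      rw [h']
      refine (norm_add_le _ _).trans ?_
      push_cast
      linarith
  -- Otherwise `a ^ k • x` is also reached by a slice element with coordinate `m'`, ‖m'‖ < ρ / 8.
  -- The two group elements differ by isotropy, which `Q` kills, so `k • m` is `m'` up to small
  -- errors, too short for its length.
  have hfar : δ ≤ C * (k * d) := by
    by_contra! hlt
    obtain ⟨hks, hkd⟩ := hdisp k le_rfl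
    obtain ⟨m', hm'Q, hm', hm'x⟩ := hδs _ hks (hkd.trans_lt hlt)
    obtain ⟨s₁, s₂⟩ := hpow k le_rfl
    have hkb := hnear k le_rfl s₂
    have hm'ball : e 1 + m' ∈ Metric.closedBall (e 1) (2 * ρ) := by
      rw [mem_closedBall_iff_norm, add_sub_cancel_left]
      linarith
    obtain ⟨t₁, t₂⟩ := hrinv _ hm'ball _ (mem_closedBall_iff_norm.2 hkb)
    rw [e.left_inv s₁] at t₁ t₂
    rw [add_sub_cancel_left] at t₂
    have hst := (hH _ t₁).2 (by rw [mul_smul, ← hm'x, inv_smul_smul])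
    have hQle : ∀ v, ∀ B, ‖v‖ ≤ η * B → ‖Q v‖ ≤ B / 16 := fun v B hv => by
      have hB : 0 ≤ B := nonneg_of_mul_nonneg_right ((norm_nonneg v).trans hv) hη
      calc ‖Q v‖ ≤ ‖Q‖ * ‖v‖ := Q.le_opNorm v
        _ ≤ ‖Q‖ * (η * B) := by gcongr
        _ = ‖Q‖ * η * B := by ring
        _ ≤ 1 / 16 * B := by gcongr
        _ = B / 16 := by ring
    have q₁ := hQle _ _ t₂
    have q₂ := hQle _ _ s₂
    rw [map_sub, hst] at q₁
    have h' : (k : ℝ) • m = m' - (0 - Q (e (a ^ k) - (e 1 + m')))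
        - Q (e (a ^ k) - e 1 - (k : ℝ) • m) := by
      have : e (a ^ k) - (e 1 + m') = (e (a ^ k) - e 1) - m' := by abel
      rw [this]
      simp only [map_sub, map_smul, hm'Q, hmQ]
      abel
    have h'' : k * ‖m‖ ≤ ‖m'‖ + (‖m'‖ + ‖e (a ^ k) - e 1‖) / 16 + k * ‖m‖ / 16 := by
      rw [← Real.norm_natCast, ← norm_smul, h']
      refine (norm_sub_le _ _).trans (add_le_add ((norm_sub_le _ _).trans
        (add_le_add le_rfl q₁)) ?_)
      rw [← h', norm_smul, Real.norm_natCast]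
      exact q₂
    linarith
  rw [div_mul_eq_mul_div, le_div_iff₀ hδ]
  have hd0 : 0 ≤ d := norm_nonneg _
  calc ‖m‖ * δ ≤ ‖m‖ * (C * (k * d)) := by gcongr
    _ = C * (k * ‖m‖) * d := by ring
    _ ≤ C * ρ * d := by gcongr

/-- The orbit map of a transitive smooth action with split isotropy is a submersion at the
identity, in charts. -/
theorem surjective_of_hasFDerivAt_orbit_chart (he : e ∈ IsManifold.maximalAtlas 𝓘(ℝ, EG) ∞ G)
    (h1 : (1 : G) ∈ e.source) (hc : c ∈ IsManifold.maximalAtlas 𝓘(ℝ, E) ∞ M) {x : M}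
    (hx : x ∈ c.source) {Q : EG →L[ℝ] EG} (hQ : ∀ v, Q (Q v) = Q v)
    (hH : ∀ a ∈ e.source, Q (e a - e 1) = 0 ↔ a • x = x) {L : EG →L[ℝ] E}
    (hL : HasFDerivAt (fun ξ => c (e.symm ξ • x)) L (e 1)) : Function.Surjective L := by
  obtain ⟨C, hC, hCm⟩ := exists_norm_le_norm_slice_smul_sub he h1 hc hx hQ hH
  have hlo : ∀ η > 0, ∀ᶠ m in 𝓝 (0 : EG),
      ‖c (e.symm (e 1 + m) • x) - c x - L m‖ ≤ η * ‖m‖ := fun η hη => by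
    have := (hasFDerivAt_iff_isLittleO_nhds_zero.1 hL).def hη
    simpa [e.left_inv h1] using this
  -- The nonlinear lower bound is applied to `t • m` with small `t`; linearization error at most
  -- half of ‖t • m‖ / C is absorbed on the left, doubling the constant.
  have hbelow : ∀ m, Q m = m → ‖m‖ ≤ 2 * C * ‖L m‖ := by
    intro m hm
    have htend : Tendsto (fun t : ℝ => t • m) (𝓝[>] 0) (𝓝 0) := by
      refine Tendsto.mono_left (Continuous.tendsto' (by fun_prop) _ _ (by simp)) nhdsWithin_le_nhds
    obtain ⟨t, ⟨t₁, t₂⟩, ht⟩ := ((htend.eventually (hCm.and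
      (hlo (1 / (2 * C)) (by positivity)))).and self_mem_nhdsWithin).exists
    have ht : 0 < t := ht
    have t₁ := t₁ (by rw [map_smul, hm])
    have key : ‖t • m‖ ≤ 2 * C * ‖L (t • m)‖ := by
      have h₁ := norm_le_insert' (c (e.symm (e 1 + t • m) • x) - c x) (L (t • m))
      have h₂ : C * ‖c (e.symm (e 1 + t • m) • x) - c x‖ ≤
          C * (‖L (t • m)‖ + 1 / (2 * C) * ‖t • m‖) :=
        mul_le_mul_of_nonneg_left (h₁.trans (by linarith)) hC.le
      have h₃ : C * (1 / (2 * C) * ‖t • m‖) = ‖t • m‖ / 2 := by field_simp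
      linarith [mul_add C ‖L (t • m)‖ (1 / (2 * C) * ‖t • m‖)]
    rw [map_smul, norm_smul, norm_smul, Real.norm_of_nonneg ht.le] at key
    refine le_of_mul_le_mul_left ?_ ht
    linarith
  -- Openness on the slice gives `m` whose orbit point has coordinate exactly `c x + t • u`, and the
  -- lower bound gives ‖m‖ ≤ C t ‖u‖. The error of `L m` against `t • u` is then o(t), so `t⁻¹ • m`
  -- is nearly a preimage of `u`.
  have hdense : ∀ u : E, ∀ κ > 0, ∃ m, Q m = m ∧ ‖L m - u‖ < κ := by
    intro u κ hκ
    let η := κ / (2 * C * (‖u‖ + 1))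
    have hη : 0 < η := by positivity
    obtain ⟨ε, hε, hεm⟩ := Metric.eventually_nhds_iff_ball.1 (hCm.and (hlo η hη))
    have hslice := eventually_exists_slice_smul_eq he h1 hc hx hQ
      (fun a ha h => (hH a ha).1 h) hε
    have hcx := c.map_source hx
    have htend : Tendsto (fun t : ℝ => c x + t • u) (𝓝[>] 0) (𝓝 (c x)) :=
      Tendsto.mono_left (Continuous.tendsto' (by fun_prop) _ _ (by simp)) nhdsWithin_le_nhds
    have hev : ∀ᶠ z in 𝓝 (c x), z ∈ c.target ∧
        ∃ m, Q m = m ∧ ‖m‖ < ε ∧ e.symm (e 1 + m) • x = c.symm z := by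
      refine (eventually_mem_set.2 (c.open_target.mem_nhds hcx)).and ?_
      have hs := c.continuousAt_symm hcx
      rw [ContinuousAt, c.left_inv hx] at hs
      exact hs.eventually hslice
    obtain ⟨t, ⟨ht₁, m, hmQ, hmε, hmt⟩, ht⟩ :=
      ((htend.eventually hev).and self_mem_nhdsWithin).exists
    have ht : 0 < t := ht
    obtain ⟨m₁, m₂⟩ := hεm m (by simpa using hmε)
    have m₁ := m₁ hmQ
    rw [hmt, c.right_inv ht₁, add_sub_cancel_left] at m₁ m₂
    refine ⟨t⁻¹ • m, by rw [map_smul, hmQ], ?_⟩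
    have h₁ : L (t⁻¹ • m) - u = -(t⁻¹ • (t • u - L m)) := by
      rw [map_smul, smul_sub, smul_smul, inv_mul_cancel₀ ht.ne', one_smul, neg_sub]
    rw [h₁, norm_neg, norm_smul, norm_inv, Real.norm_of_nonneg ht.le, inv_mul_lt_iff₀ ht]
    rw [norm_smul, Real.norm_of_nonneg ht.le] at m₁
    calc ‖t • u - L m‖ ≤ η * ‖m‖ := m₂
      _ ≤ η * (C * (t * ‖u‖)) := by gcongr
      _ = t * (κ * (‖u‖ / (2 * (‖u‖ + 1)))) := by
        simp only [η]
        field_simp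
      _ < t * (κ * 1) := by
        gcongr
        rw [div_lt_one (by positivity)]
        linarith [norm_nonneg u]
      _ = t * κ := by ring
  let 𝔪 : Submodule ℝ EG :=
    LinearMap.ker ((Q - ContinuousLinearMap.id ℝ EG : EG →L[ℝ] EG) : EG →ₗ[ℝ] EG)
  have h𝔪 : ∀ m, m ∈ 𝔪 ↔ Q m = m := fun m => by simp [𝔪, sub_eq_zero]
  have : CompleteSpace 𝔪 :=
    (ContinuousLinearMap.isClosed_ker (Q - ContinuousLinearMap.id ℝ EG)).completeSpace_coe
  let L' : 𝔪 →L[ℝ] E := L.comp 𝔪.subtypeL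
  have hanti : AntilipschitzWith (2 * C).toNNReal L' := by
    refine AddMonoidHomClass.antilipschitz_of_bound L' fun m => ?_
    rw [Real.coe_toNNReal _ (by positivity)]
    exact hbelow m ((h𝔪 m).1 m.2)
  have hclosed : IsClosed (range L') := hanti.isClosed_range L'.uniformContinuous
  intro u
  have hu : u ∈ closure (range L') := by
    rw [Metric.mem_closure_iff]
    intro κ hκ
    obtain ⟨m, hm, hmu⟩ := hdense u κ hκ
    exact ⟨L m, ⟨⟨m, (h𝔪 m).2 hm⟩, rfl⟩, by rwa [dist_comm, dist_eq_norm]⟩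
  rw [hclosed.closure_eq] at hu
  obtain ⟨m, hm⟩ := hu
  exact ⟨m, hm⟩

end Submersion

/-! ### Fundamental vector fields and one-parameter subgroups -/

theorem contDiffAt_infty_of_eventually_hasDerivAt {F : Type*} [NormedAddCommGroup F]
    [NormedSpace ℝ F] {f : ℝ → F} {V : F → F} {t : ℝ} (hV : ContDiffAt ℝ ∞ V (f t))
    (hf : ∀ᶠ s in 𝓝 t, HasDerivAt f (V (f s)) s) : ContDiffAt ℝ ∞ f t := by
  rw [contDiffAt_infty]
  intro n
  -- Bootstrapping the equation f' = V ∘ f: if f is Cⁿ then so is f', hence f is Cⁿ⁺¹.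
  induction n with
  | zero =>
    refine contDiffAt_zero.2 ⟨_, hf, fun s hs => ?_⟩
    exact HasDerivAt.continuousAt (by exact hs) |>.continuousWithinAt
  | succ n ih =>
    refine contDiffAt_succ_iff_hasFDerivAt.2
      ⟨fun s => ContinuousLinearMap.toSpanSingleton ℝ (V (f s)), ⟨_, hf, fun s hs => ?_⟩, ?_⟩
    · exact HasDerivAt.hasFDerivAt (by exact hs)
    · exact (ContinuousLinearMap.toSpanSingletonCLE (𝕜 := ℝ) (E := F)).contDiff.contDiffAt.comp t
        ((hV.of_le (by exact_mod_cast le_top)).comp t ih)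

section

variable {EG G E M : Type*} [NormedAddCommGroup EG] [NormedSpace ℝ EG]
  [Group G] [TopologicalSpace G] [ChartedSpace EG G] [LieGroup 𝓘(ℝ, EG) ∞ G]
  [NormedAddCommGroup E] [NormedSpace ℝ E]
  [TopologicalSpace M] [ChartedSpace E M] [IsManifold 𝓘(ℝ, E) ∞ M]
  [MulAction G M] [ContMDiffSMul 𝓘(ℝ, EG) 𝓘(ℝ, E) ∞ G M]

omit [LieGroup 𝓘(ℝ, EG) ∞ G] [IsManifold 𝓘(ℝ, E) ∞ M] in
theorem contMDiff_smul_left (y : M) : ContMDiff 𝓘(ℝ, EG) 𝓘(ℝ, E) ∞ (fun a : G => a • y) :=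
  (contMDiff_smul (I := 𝓘(ℝ, EG)) (I' := 𝓘(ℝ, E)) (n := ∞)).comp
    (contMDiff_id.prodMk contMDiff_const)

omit [LieGroup 𝓘(ℝ, EG) ∞ G] [IsManifold 𝓘(ℝ, E) ∞ M] in
theorem mdifferentiableAt_smul_left (a : G) (y : M) :
    MDifferentiableAt 𝓘(ℝ, EG) 𝓘(ℝ, E) (fun a : G => a • y) a :=
  (contMDiff_smul_left y).mdifferentiable (by simp) a

variable (M) in
/-- The fundamental vector field of a smooth action, associated with an element of the Lie
algebra. -/
def fundamentalVectorField (v : TangentSpace 𝓘(ℝ, EG) (1 : G)) : SmoothVectorField E M where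
  toFun y := mfderiv 𝓘(ℝ, EG) 𝓘(ℝ, E) (fun a : G => a • y) 1 v
  contMDiff_toFun := by
    -- The field is the tangent map of the action applied to `v` at 1 and the zero vector at `y`,
    -- hence a composition of smooth maps.
    let F₁ : M → TangentBundle 𝓘(ℝ, EG) G × TangentBundle 𝓘(ℝ, E) M :=
      fun y => (TotalSpace.mk' EG 1 v, TotalSpace.mk' E y 0)
    have S₁ : ContMDiff 𝓘(ℝ, E) (𝓘(ℝ, EG).tangent.prod 𝓘(ℝ, E).tangent) ∞ F₁ :=
      contMDiff_const.prodMk (contMDiff_zeroSection ℝ (TangentSpace 𝓘(ℝ, E) (M := M)))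
    have S₂ : ContMDiff (𝓘(ℝ, EG).tangent.prod 𝓘(ℝ, E).tangent)
        (𝓘(ℝ, EG).prod 𝓘(ℝ, E)).tangent ∞ (equivTangentBundleProd 𝓘(ℝ, EG) G 𝓘(ℝ, E) M).symm :=
      contMDiff_equivTangentBundleProd_symm
    have hsm : ContMDiff (𝓘(ℝ, EG).prod 𝓘(ℝ, E)) 𝓘(ℝ, E) ∞ (fun p : G × M => p.1 • p.2) :=
      contMDiff_smul
    have S₃ := hsm.contMDiff_tangentMap (m := ∞) le_rfl
    refine ((S₃.comp S₂).comp S₁).congr fun y => ?_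
    have hD := mfderiv_prod_eq_add_apply (hsm.mdifferentiable (by simp) ((1 : G), y))
      (v := ((v, 0) : EG × E))
    have hbase : ∀ (z : M) (w u : E), z = y → w = u →
        (⟨y, u⟩ : TangentBundle 𝓘(ℝ, E) M) = ⟨z, w⟩ := by
      rintro z w u rfl rfl
      rfl
    refine hbase _ _ _ (one_smul G y) (hD.trans ?_)
    exact (congrArg (_ + ·) (map_zero _)).trans (add_zero _)

/-- The image in `M` of an integral curve of a right invariant vector field on `G` is an integral
curve of the corresponding fundamental vector field. -/
theorem IsMIntegralCurveOn.smul_const {v : TangentSpace 𝓘(ℝ, EG) (1 : G)} {γ : ℝ → G} {s : Set ℝ}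
    (hγ : IsMIntegralCurveOn (I := 𝓘(ℝ, EG)) γ (fun a => fundamentalVectorField (E := EG) G v a) s)
    (y : M) :
    IsMIntegralCurveOn (I := 𝓘(ℝ, E)) (fun t => γ t • y)
      (fun z => fundamentalVectorField (E := E) M v z) s := by
  intro t ht
  have h := (mdifferentiableAt_smul_left (E := E) (γ t) y).hasMFDerivAt.comp_hasMFDerivWithinAt t (hγ t ht)
  refine h.congr_mfderiv ?_
  -- Associativity of the action: differentiating at 1 shows that the orbit map of `y` carries the
  -- right invariant field to the fundamental field.
  have hcomp : (fun a : G => a • γ t • y) = (fun a : G => a • y) ∘ (fun a : G => a • γ t) := by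
    ext a
    simp [mul_smul]
  have key : mfderiv 𝓘(ℝ, EG) 𝓘(ℝ, E) (fun a : G => a • y) (γ t)
      (fundamentalVectorField (E := EG) G v (γ t)) =
        fundamentalVectorField (E := E) M v (γ t • y) := by
    have hD : mfderiv 𝓘(ℝ, EG) 𝓘(ℝ, E) (fun a : G => a • γ t • y) 1 =
        (mfderiv 𝓘(ℝ, EG) 𝓘(ℝ, E) (fun a : G => a • y) ((1 : G) • γ t)).comp
          (mfderiv 𝓘(ℝ, EG) 𝓘(ℝ, EG) (fun a : G => a • γ t) 1) := by
      rw [hcomp]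
      exact mfderiv_comp (I' := 𝓘(ℝ, EG)) 1 (mdifferentiableAt_smul_left _ _)
        (mdifferentiableAt_smul_left _ _)
    have hbase : ∀ (b : G) (w : EG), b = γ t →
        (mfderiv 𝓘(ℝ, EG) 𝓘(ℝ, E) (fun a : G => a • y) (γ t) w : E) =
          (mfderiv 𝓘(ℝ, EG) 𝓘(ℝ, E) (fun a : G => a • y) b w : E) := by
      rintro b w rfl
      rfl
    exact (hbase _ _ (one_smul G (γ t))).trans (congrArg (fun D : EG →L[ℝ] E => D v) hD).symm
  refine ContinuousLinearMap.ext fun r => ?_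
  exact (map_smul (mfderiv 𝓘(ℝ, EG) 𝓘(ℝ, E) (fun a : G => a • y) (γ t)) _ _).trans
    (congrArg (fun w : E => (show ℝ from r) • w) key)

section OneParameter

variable [CompleteSpace EG] [T2Space G]

/-- Every element of the Lie algebra of a Banach Lie group generates a smooth one-parameter
subgroup. -/
theorem exists_oneParameterSubgroup (v : TangentSpace 𝓘(ℝ, EG) (1 : G)) :
    ∃ γ : ℝ → G, ContMDiff 𝓘(ℝ, ℝ) 𝓘(ℝ, EG) ∞ γ ∧ γ 0 = 1 ∧
      (∀ s t, γ (t + s) = γ t * γ s) ∧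
      IsMIntegralCurve (I := 𝓘(ℝ, EG)) γ (fun a => fundamentalVectorField (E := EG) G v a) := by
  let R : SmoothVectorField EG G := fundamentalVectorField (E := EG) G v
  have hR : ContMDiff 𝓘(ℝ, EG) 𝓘(ℝ, EG).tangent 1
    (fun a : G => (⟨a, R a⟩ : TangentBundle 𝓘(ℝ, EG) G)) := R.contMDiff.of_le (by simp)
  obtain ⟨γ₀, hγ₀, hγ₀'⟩ := exists_isMIntegralCurveAt_of_contMDiffAt_boundaryless 0
    (hR.contMDiffAt (x := (1 : G)))
  obtain ⟨ε, hε, hγε⟩ := isMIntegralCurveAt_iff'.1 hγ₀'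
  rw [Real.ball_eq_Ioo, zero_sub, zero_add] at hγε
  -- Right translates of one local integral curve start at every group element with the same
  -- lifetime `ε`, so the right invariant field is complete.
  obtain ⟨γ, hγ0, hγ⟩ := exists_isMIntegralCurve_of_isMIntegralCurveOn hR hε
    (fun a => ⟨fun t => γ₀ t • a, by simp [hγ₀], hγε.smul_const a⟩) (1 : G)
  -- As functions of `t`, both sides are integral curves agreeing at 0, so uniqueness applies.
  have hadd : ∀ s t, γ (t + s) = γ t * γ s := fun s t => by
    have h₁ : IsMIntegralCurve (γ ∘ (· + s)) (fun a => R a) := hγ.comp_add s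
    have h₂ : IsMIntegralCurve (I := 𝓘(ℝ, EG)) (fun t => γ t • γ s) (fun a => R a) := by
      rw [isMIntegralCurve_iff_isMIntegralCurveOn] at hγ ⊢
      exact hγ.smul_const (γ s)
    have := isMIntegralCurve_Ioo_eq_of_contMDiff_boundaryless (t₀ := 0) hR h₁ h₂
      (by simp [hγ0])
    exact congrFun this t
  refine ⟨γ, ?_, hγ0, hadd, hγ⟩
  have hsmooth0 : ContMDiffAt 𝓘(ℝ, ℝ) 𝓘(ℝ, EG) ∞ γ 0 := by
    have hd := (hγ.isMIntegralCurveAt 0).eventually_hasDerivAt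
    rw [contMDiffAt_iff_target]
    refine ⟨(hγ.continuous).continuousAt, ?_⟩
    rw [contMDiffAt_iff_contDiffAt]
    have hV := (Bundle.contMDiffAt_section _).1 (R.contMDiff.contMDiffAt (x := γ 0))
    let W : G → EG := fun a => tangentCoordChange 𝓘(ℝ, EG) a (γ 0) a (R a)
    have hVs : ContDiffAt ℝ ∞ (W ∘ (extChartAt 𝓘(ℝ, EG) (γ 0)).symm) ((extChartAt 𝓘(ℝ, EG) (γ 0) ∘ γ) 0) := by
      rw [← contMDiffAt_iff_contDiffAt]
      have hsym : ContMDiffAt 𝓘(ℝ, EG) 𝓘(ℝ, EG) ∞ (extChartAt 𝓘(ℝ, EG) (γ 0)).symm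
          (extChartAt 𝓘(ℝ, EG) (γ 0) (γ 0)) :=
        (contMDiffOn_extChartAt_symm (γ 0)).contMDiffAt (extChartAt_target_mem_nhds (γ 0))
      exact ContMDiffAt.comp_of_eq hV hsym (extChartAt_to_inv (γ 0))
    refine contDiffAt_infty_of_eventually_hasDerivAt hVs ?_
    filter_upwards [hd, hγ.continuous.continuousAt.eventually_mem
      (extChartAt_source_mem_nhds (I := 𝓘(ℝ, EG)) (γ 0))] with t ht hts
    exact ht.congr_deriv (congrArg W ((extChartAt 𝓘(ℝ, EG) (γ 0)).left_inv hts).symm)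
  intro t
  -- Smoothness at 0 is carried to time `t` by right translation.
  have : γ = (fun a => a * γ t) ∘ γ ∘ (fun s => s - t) := by
    ext s
    simp [← hadd]
  have hcomp : ContMDiffAt 𝓘(ℝ, ℝ) 𝓘(ℝ, EG) ∞ ((fun a => a * γ t) ∘ γ ∘ (fun s => s - t)) t := by
    refine ContMDiffAt.comp t (contMDiff_mul_right (I := 𝓘(ℝ, EG)) (n := ∞)).contMDiffAt
      (ContMDiffAt.comp_of_eq hsmooth0 ?_ (sub_self t))
    exact (contDiff_id.sub contDiff_const).contMDiff.contMDiffAt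
  rwa [← this] at hcomp

end OneParameter

end

/-! ### Orbit derivatives and Killing fields -/

theorem IsBanachLieSubgroup.exists_chart_projection {EG G : Type*} [NormedAddCommGroup EG]
    [NormedSpace ℝ EG] [Group G] [TopologicalSpace G] [ChartedSpace EG G]
    [LieGroup 𝓘(ℝ, EG) ∞ G] {H : Subgroup G} (hH : IsBanachLieSubgroup EG H) :
    ∃ e ∈ IsManifold.maximalAtlas 𝓘(ℝ, EG) ∞ G, (1 : G) ∈ e.source ∧
      ∃ Q : EG →L[ℝ] EG, (∀ v, Q (Q v) = Q v) ∧ ∀ a ∈ e.source, Q (e a - e 1) = 0 ↔ a ∈ H := by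
  obtain ⟨e, he, h1, 𝔥, ⟨P, hP⟩, hmem⟩ := hH
  have hPP : ∀ v, (P (P v : EG) : EG) = P v := fun v => by rw [hP]
  -- Here the splitting enters: the complementary projection `Q` has kernel 𝔥, so subgroup
  -- membership becomes a linear equation, and its range supplies the slice.
  refine ⟨e, he, h1, ContinuousLinearMap.id ℝ EG - 𝔥.subtypeL.comp P, fun v => ?_,
    fun a ha => ?_⟩
  · simp [hPP]
  · rw [hmem a ha]
    refine ⟨fun h => ?_, fun h => ?_⟩
    · have h' : e a - e 1 = P (e a - e 1) := by
        simpa [sub_eq_zero] using h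
      rw [h']
      exact (P _).2
    · have := congrArg Subtype.val (hP ⟨_, h⟩)
      simpa [sub_eq_zero] using this.symm

section

variable {EG G E M : Type*}
  [NormedAddCommGroup EG] [NormedSpace ℝ EG] [CompleteSpace EG]
  [Group G] [TopologicalSpace G] [ChartedSpace EG G] [LieGroup 𝓘(ℝ, EG) ∞ G]
  [NormedAddCommGroup E] [NormedSpace ℝ E]
  [TopologicalSpace M] [ChartedSpace E M] [IsManifold 𝓘(ℝ, E) ∞ M]
  [MulAction G M]

/-- The orbit maps of a homogeneous space of a separable Banach Lie group are submersions. -/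
theorem IsHomogeneousGSpace.surjective_mfderiv_smul [SecondCountableTopology G] [CompleteSpace E]
    (h : IsHomogeneousGSpace EG G E M) (x : M) :
    Function.Surjective (mfderiv 𝓘(ℝ, EG) 𝓘(ℝ, E) (fun a : G => a • x) 1) := by
  have := h.smooth
  have := h.transitive
  obtain ⟨e, he, h1, Q, hQ, hH⟩ := (h.isotropy x).exists_chart_projection
  let c := chartAt E x
  have hc : c ∈ IsManifold.maximalAtlas 𝓘(ℝ, E) ∞ M := IsManifold.chart_mem_maximalAtlas x
  have hx : x ∈ c.source := mem_chart_source E x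
  have hes : MDifferentiableAt 𝓘(ℝ, EG) 𝓘(ℝ, EG) e.symm (e 1) :=
    (contMDiffAt_symm_of_mem_maximalAtlas he (e.map_source h1)).mdifferentiableAt (by simp)
  have hcd : MDifferentiableAt 𝓘(ℝ, E) 𝓘(ℝ, E) c x :=
    (contMDiffAt_of_mem_maximalAtlas hc hx).mdifferentiableAt (by simp)
  have hp := mdifferentiableAt_smul_left (EG := EG) (E := E) (1 : G) x
  have h₁ : HasMFDerivAt 𝓘(ℝ, EG) 𝓘(ℝ, E) (fun ξ => e.symm ξ • x) (e 1)
      ((mfderiv 𝓘(ℝ, EG) 𝓘(ℝ, E) (fun a : G => a • x) 1).comp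
        (mfderiv 𝓘(ℝ, EG) 𝓘(ℝ, EG) e.symm (e 1))) := by
    refine HasMFDerivAt.comp (g := fun a : G => a • x) (e 1) ?_ hes.hasMFDerivAt
    rw [e.left_inv h1]
    exact hp.hasMFDerivAt
  have h₂ : HasMFDerivAt 𝓘(ℝ, EG) 𝓘(ℝ, E) (fun ξ => c (e.symm ξ • x)) (e 1)
      ((mfderiv 𝓘(ℝ, E) 𝓘(ℝ, E) c x).comp
        ((mfderiv 𝓘(ℝ, EG) 𝓘(ℝ, E) (fun a : G => a • x) 1).comp
        (mfderiv 𝓘(ℝ, EG) 𝓘(ℝ, EG) e.symm (e 1)))) := by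
    refine HasMFDerivAt.comp (g := c) (e 1) ?_ h₁
    rw [e.left_inv h1, one_smul]
    exact hcd.hasMFDerivAt
  have hsurj := surjective_of_hasFDerivAt_orbit_chart he h1 hc hx hQ
    (fun a ha => (hH a ha).trans MulAction.mem_stabilizer_iff) h₂.hasFDerivAt
  intro u
  obtain ⟨ξ, hξ⟩ := hsurj (mfderiv 𝓘(ℝ, E) 𝓘(ℝ, E) c x u)
  refine ⟨mfderiv 𝓘(ℝ, EG) 𝓘(ℝ, EG) e.symm (e 1) ξ, ?_⟩
  -- The two vectors agree after the derivative of the chart, which is injective.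
  exact (mdifferentiable_chart (I := 𝓘(ℝ, E)) x).mfderiv_injective hx hξ

/-- The fundamental vector fields of an isometric action are Killing vector fields. -/
theorem isKillingField_fundamentalVectorField [T2Space G] [ContMDiffSMul 𝓘(ℝ, EG) 𝓘(ℝ, E) ∞ G M]
    {g : SmoothMetric E M} (hg : ∀ a : G, PreservesMetric g (fun y : M => a • y))
    (v : TangentSpace 𝓘(ℝ, EG) (1 : G)) : IsKillingField g (fundamentalVectorField M v) := by
  obtain ⟨γ, hγ, hγ0, -, hγ'⟩ := exists_oneParameterSubgroup v
  refine ⟨fun t y => γ t • y, (hγ.comp contMDiff_fst).smul contMDiff_snd, fun y => ?_, fun y => ?_,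
    fun t => hg (γ t)⟩
  · simp [hγ0]
  · rw [isMIntegralCurve_iff_isMIntegralCurveOn] at hγ' ⊢
    exact hγ'.smul_const y

/-- Every tangent vector of a Riemannian symmetric space extends to a Killing vector field. -/
theorem RiemannianSymmetricGSpace.exists_isKillingField [T2Space G] [SecondCountableTopology G]
    [CompleteSpace E] (S : RiemannianSymmetricGSpace EG G E M) (x : M)
    (u : TangentSpace 𝓘(ℝ, E) x) :
    ∃ K : SmoothVectorField E M, IsKillingField S.g K ∧ K x = u := by
  have := S.homogeneous.smooth
  obtain ⟨v, hv⟩ := S.homogeneous.surjective_mfderiv_smul x u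
  exact ⟨fundamentalVectorField M v, isKillingField_fundamentalVectorField S.metric_invariant v, hv⟩

end

/-! ### The optimal constant and dispersions -/

section Dispersion

variable {E M : Type*} [NormedAddCommGroup E] [NormedSpace ℝ E]
  [TopologicalSpace M] [ChartedSpace E M] [IsManifold 𝓘(ℝ, E) ∞ M]
  {g : SmoothMetric E M} {J : AlmostComplexStructure E M}

theorem metric_self_nonneg (g : SmoothMetric E M) (x : M) (v : TangentSpace 𝓘(ℝ, E) x) :
    0 ≤ g.inner x v v := by
  rcases eq_or_ne v 0 with rfl | hv
  · simp
  · exact (g.pos x v hv).le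

theorem sq_metricNorm (g : SmoothMetric E M) (x : M) (v : TangentSpace 𝓘(ℝ, E) x) :
    metricNorm g x v ^ 2 = g.inner x v v := Real.sq_sqrt (metric_self_nonneg g x v)

/-- The Cauchy–Schwarz inequality for a Riemannian metric. -/
theorem abs_metric_le (g : SmoothMetric E M) (x : M) (v w : TangentSpace 𝓘(ℝ, E) x) :
    |g.inner x v w| ≤ metricNorm g x v * metricNorm g x w := by
  rw [metricNorm, metricNorm, ← Real.sqrt_mul (metric_self_nonneg g x v)]
  apply Real.abs_le_sqrt
  have h : ∀ t : ℝ, 0 ≤ g.inner x w w * (t * t) + 2 * g.inner x v w * t + g.inner x v v := by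
    intro t
    have := metric_self_nonneg g x (v + t • w)
    simp only [map_add, map_smul, add_apply, smul_apply,
      smul_eq_mul, g.symm x w v] at this
    linarith
  have := discrim_le_zero h
  rw [discrim] at this
  linarith

theorem metricNorm_complexStructure (hJ : IsHermitianMetric g J) (x : M)
    (v : TangentSpace 𝓘(ℝ, E) x) : metricNorm g x (J.toFun x v) = metricNorm g x v := by
  rw [metricNorm, hJ, metricNorm]

theorem uncertaintyBound_one (hJ : IsHermitianMetric g J) : UncertaintyBound g J 1 := by
  intro x v w
  rw [one_mul, ← metricNorm_complexStructure hJ x v]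
  exact abs_metric_le g x _ w

theorem uncertaintyConstant_nonneg (g : SmoothMetric E M) (J : AlmostComplexStructure E M) :
    0 ≤ uncertaintyConstant g J := Real.sInf_nonneg fun _ h => h.1

/-- For fixed vectors the admissible constants form a closed set, so the bound passes to the
infimum, which lies in the closure because 1 is admissible. -/
theorem uncertaintyBound_uncertaintyConstant (hJ : IsHermitianMetric g J) :
    UncertaintyBound g J (uncertaintyConstant g J) := by
  intro x v w
  have hc : IsClosed {a : ℝ | |fundamentalForm g J x v w| ≤
      a * (metricNorm g x v * metricNorm g x w)} :=
    isClosed_le continuous_const (continuous_id.mul continuous_const)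
  have hne : {a : ℝ | 0 ≤ a ∧ UncertaintyBound g J a}.Nonempty :=
    ⟨1, zero_le_one, uncertaintyBound_one hJ⟩
  exact closure_minimal (fun a ha => ha.2 x v w) hc (csInf_mem_closure hne ⟨0, fun _ h => h.1⟩)

theorem fundamentalForm_complexStructure (hJ : IsHermitianMetric g J) (x : M)
    (v : TangentSpace 𝓘(ℝ, E) x) : fundamentalForm g J x v (J.toFun x v) = metricNorm g x v ^ 2 := by
  rw [fundamentalForm, hJ, sq_metricNorm]

/-- The pair v, Jv attains equality with constant 1, so no smaller constant is admissible. A nonzero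
vector is needed: on a point, r = 0. -/
theorem uncertaintyConstant_eq_one (hJ : IsHermitianMetric g J) {x : M}
    {v : TangentSpace 𝓘(ℝ, E) x} (hv : v ≠ 0) : uncertaintyConstant g J = 1 := by
  apply le_antisymm
  · exact csInf_le ⟨0, fun _ h => h.1⟩ ⟨zero_le_one, uncertaintyBound_one hJ⟩
  · have h := uncertaintyBound_uncertaintyConstant hJ x v (J.toFun x v)
    rw [fundamentalForm_complexStructure hJ, metricNorm_complexStructure hJ,
      abs_of_nonneg (sq_nonneg _), ← sq] at h
    have hpos : 0 < metricNorm g x v ^ 2 := by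
      rw [sq_metricNorm]
      exact g.pos x v hv
    exact le_of_mul_le_mul_right (by rwa [one_mul]) hpos

theorem dispersion_mul_dispersion (X Y : SmoothVectorField E M) (x : M) :
    dispersion g J X x * dispersion g J Y x =
      1 / 2 * (uncertaintyConstant g J * (metricNorm g x (X x) * metricNorm g x (Y x))) := by
  have h := Real.mul_self_sqrt (div_nonneg (uncertaintyConstant_nonneg g J) zero_le_two)
  rw [dispersion, dispersion, mul_mul_mul_comm, h]
  ring

end Dispersion

theorem proposition8 {EG G E M : Type*}
    [NormedAddCommGroup EG] [NormedSpace ℝ EG] [CompleteSpace EG]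
    [Group G] [TopologicalSpace G] [ChartedSpace EG G] [LieGroup 𝓘(ℝ, EG) ∞ G]
    [T2Space G] [SecondCountableTopology G]
    [NormedAddCommGroup E] [NormedSpace ℝ E] [CompleteSpace E]
    [TopologicalSpace M] [ChartedSpace E M] [IsManifold 𝓘(ℝ, E) ∞ M]
    [T2Space M] [SecondCountableTopology M] [ConnectedSpace M]
    [MulAction G M]
    (S : HermitianSymmetricGSpace EG G E M) (X : SmoothVectorField E M) (x : M) :
    (∀ Y : SmoothVectorField E M,
      (1 / 2 : ℝ) * |fundamentalForm S.g S.J x (X x) (Y x)| ≤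
        dispersion S.g S.J X x * dispersion S.g S.J Y x) ∧
    ∃ K : SmoothVectorField E M, IsKillingField S.g K ∧ K x = S.J.toFun x (X x) ∧
      dispersion S.g S.J X x * dispersion S.g S.J K x =
        (1 / 2 : ℝ) * |fundamentalForm S.g S.J x (X x) (K x)| := by
  refine ⟨fun Y => ?_, ?_⟩
  · rw [dispersion_mul_dispersion]
    exact mul_le_mul_of_nonneg_left (uncertaintyBound_uncertaintyConstant S.hermitian x _ _)
      (by norm_num)
  · obtain ⟨K, hK, hKx⟩ := S.exists_isKillingField x (S.J.toFun x (X x))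
    refine ⟨K, hK, hKx, ?_⟩
    rw [dispersion_mul_dispersion, hKx, fundamentalForm_complexStructure S.hermitian,
      metricNorm_complexStructure S.hermitian, abs_of_nonneg (sq_nonneg _), ← sq]
    -- If X vanishes at x, both sides are zero whatever r is.
    rcases eq_or_ne (X x) 0 with h0 | h0
    · simp [h0, metricNorm]
    · rw [uncertaintyConstant_eq_one S.hermitian h0, one_mul]

end
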